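/- Consider the problem (NCP): minimize $f_0(x)$ subject to $f_j(x)\le 0$, $j\in I=\{1,\dots,m\}$, $x\in\mathbb R^n$, and write $g_j=\nabla f_j$ for $j\in\{0\}\cup I$. A pair $(x,\lambda)\in\mathbb R^n\times\mathbb R^m$ is a KKT pair if $g_0(x)+\sum_{j\in I}\lambda_jg_j(x)=0$ and $f_j(x)\le0$, $\lambda_j\ge0$, $\lambda_jf_j(x)=0$ for all $j\in I$; then $x$ is called a KKT point. Put $$I^-(x)=\{j\in I: f_j(x)\le0\},\quad I^+(x)=\{j\in I:f_j(x)>0\},\quad \varphi(x)=\max\{0,\ f_j(x)\ (j\in I)\},$$ $\bar f_j(x)=f_j(x)$ for $j\in I^-(x)$, $\bar f_j(x)=f_j(x)-\varphi(x)$ for $j\in I^+(x)$, and $I(x)=\{j\in I:\bar f_j(x)=0\}$. **Algorithm.** Parameters: $\gamma,\eta,\varepsilon\in(0,1)$, $0<\theta<\sigma<1$, $0<\varrho<\sigma$, $\xi,\zeta>0$, $\alpha\in(0,\tfrac12)$, $\rho>1$, $\delta>2$, $\tau\in(2,3)$. Data: $x^0\in\mathbb R^n$ and a symmetric positive definite $B_0\in\mathbb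 R^{n\times n}$. Put $k=0$. Write $\varphi_k=\varphi(x^k)$. *Step 1.* Let $d_0^k$ be the solution of the quadratic program: minimize $g_0(x^k)^Td+\frac12d^TB_kd$ subject to $\bar f_j(x^k)+g_j(x^k)^Td\le0$, $j\in I$, and let $\lambda^k$ be a corresponding KKT multiplier vector, that is, $g_0(x^k)+B_kd_0^k+\sum_{j\in I}\lambda^k_jg_j(x^k)=0$ and $\lambda_j^k\ge0$, $\lambda_j^k(\bar f_j(x^k)+g_j(x^k)^Td_0^k)=0$ for all $j\in I$. If $(d_0^k,\varphi_k)=(0,0)$, stop. *Step 2.* Let $V_k=\begin{pmatrix}B_k&N_k\\N_k^T&-D^k\end{pmatrix}$ with $N_k=(g_j(x^k))_{j\in I}$ and $D^k=\mathrm{diag}(D^k_j)_{j\in I}$, $D_j^k=|\bar f_j(x^k)|\,\bigl(|\bar f_j(x^k)+g_j(x^k)^Td_0^k|+\|d_0^k\|\bigr)$. Let $(d_1^k,h_1^k)$ solve $V_k\binom dh=\binom0r$ with $r_j=-(\|d_0^k\|^\tau+\varphi_k^\sigma)-\bigl(f_j(x^k+d_0^k)-f_j(x^k)-g_j(x^k)^Td_0^k\bigr)$,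 and put $d^k=d_0^k+d_1^k$. If $g_0(x^k)^Td_0^k\le\zeta\min\{-\|d_0^k\|^\delta,-\|d^k\|^\delta\}+\xi\varphi_k^\varrho$, go to Step 3; otherwise go to Step 4. *Step 3.* Let $t_k$ be the first $t$ among those numbers $1,\frac12,\frac14,\dots$ that are at least $\varepsilon$ such that $f_0(x^k+td^k)\le f_0(x^k)+\alpha t\,g_0(x^k)^Td_0^k+\rho(1-\alpha)t\varphi_k^\theta$, $f_j(x^k+td^k)\le\varphi_k-\alpha t(\|d_0^k\|^\tau+\varphi_k^\sigma)$ for $j\in I^+(x^k)$, and $f_j(x^k+td^k)\le0$ for $j\in I^-(x^k)$; go to Step 6. If there is none, go to Step 4. *Step 4.* Let $(\tilde d^k,\tilde h^k)$ solve $V_k\binom dh=\binom0r$ with $r_j=-(\|d_0^k\|+\varphi_k^\sigma)$ for all $j\in I$. Let $\beta_k=\min\Bigl\{1,\frac{(\theta-1)g_0(x^k)^Td_0^k+\varphi_k^\theta}{g_0(x^k)^T\tilde d^k-g_0(x^k)^Td_0^k}\Bigr\}$ if $g_0(x^k)^T\tilde d^k>g_0(x^k)^Td_0^k$ and $\beta_k=1$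 otherwise, and put $q^k=(1-\beta_k)d_0^k+\beta_k\tilde d^k$. *Step 5.* Let $t_k$ be the first $t$ among $1,\eta,\eta^2,\dots$ such that $f_0(x^k+tq^k)\le f_0(x^k)+\gamma t\,g_0(x^k)^Tq^k+\rho(1-\gamma)t\varphi_k^\theta$, $f_j(x^k+tq^k)\le\varphi_k-\gamma t\beta_k(\|d_0^k\|+\varphi_k^\sigma)$ for $j\in I^+(x^k)$, and $f_j(x^k+tq^k)\le0$ for $j\in I^-(x^k)$. Put $d^k=q^k$. *Step 6.* Choose a symmetric positive definite matrix $B_{k+1}$, put $x^{k+1}=x^k+t_kd^k$, replace $k$ by $k+1$ and go to Step 1. **Theorem.** Assume that $f_j$, $j\in\{0\}\cup I$, are continuously differentiable and that for every $x\in\mathbb R^n$ the vectors $g_j(x)$, $j\in I(x)$, are linearly independent. Then the algorithm is well defined: from every $x^0$ and for every choice of symmetric positive definite matrices $B_k$, each step can be carried out as long as the algorithm has not stopped. If moreover the matrices $B_k$ are uniformly positive definite, i.e. there are $a,b>0$ with $a\|d\|^2\le d^TB_kd\le b\|d\|^2$ for all $d\in\mathbb R^n$ and all $k$, then the algorithm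 either stops after finitely many iterations at a KKT point $x^k$ of (NCP), or it generates an infinite sequence $\{x^k\}$ each of whose accumulation points $x^*$ (if any) is a KKT point of (NCP); furthermore, for each such $x^*$ there are an infinite index set $K$ and $\lambda^*\in\mathbb R^m$ such that $(x^k,\lambda^k)\to(x^*,\lambda^*)$ as $k\to\infty$, $k\in K$, and $(x^*,\lambda^*)$ is a KKT pair of (NCP). -/

import Mathlib

/-- Data of the problem `min f0(x)` subject to `f j x ≤ 0` for all `j`. -/
structure NCP (n m : ℕ) where
  f0 : EuclideanSpace ℝ (Fin n) → ℝ
  f : Fin m → EuclideanSpace ℝ (Fin n) → ℝ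

namespace NCP

noncomputable section

variable {n m : ℕ} (P : NCP n m)

/-- The gradient of the objective. -/
def g0 (x : EuclideanSpace ℝ (Fin n)) : EuclideanSpace ℝ (Fin n) := gradient P.f0 x

/-- The gradients of the constraint functions. -/
def g (j : Fin m) (x : EuclideanSpace ℝ (Fin n)) : EuclideanSpace ℝ (Fin n) := gradient (P.f j) x

/-- `(x, lam)` is a KKT pair. -/
def IsKKTPair (x : EuclideanSpace ℝ (Fin n)) (lam : Fin m → ℝ) : Prop :=
  P.g0 x + ∑ j, lam j • P.g j x = 0 ∧
    ∀ j, P.f j x ≤ 0 ∧ 0 ≤ lam j ∧ lam j * P.f j x = 0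

/-- `x` is a KKT point. -/
def IsKKTPoint (x : EuclideanSpace ℝ (Fin n)) : Prop := ∃ lam, P.IsKKTPair x lam

/-- The indices of the satisfied constraints. -/
def Iminus (x : EuclideanSpace ℝ (Fin n)) : Set (Fin m) := {j | P.f j x ≤ 0}

/-- The indices of the violated constraints. -/
def Iplus (x : EuclideanSpace ℝ (Fin n)) : Set (Fin m) := {j | 0 < P.f j x}

/-- The maximal violation `max {0, f j x : j}`. -/
def phi (x : EuclideanSpace ℝ (Fin n)) : ℝ := Finset.univ.fold max 0 (fun j => P.f j x)

/-- `f j x` on satisfied constraints, `f j x - phi x` on violated ones. -/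
def fbar (j : Fin m) (x : EuclideanSpace ℝ (Fin n)) : ℝ :=
  if P.f j x ≤ 0 then P.f j x else P.f j x - P.phi x

/-- The generalized active set `I(x)`. -/
def active (x : EuclideanSpace ℝ (Fin n)) : Set (Fin m) := {j | P.fbar j x = 0}

/-- All functions are continuously differentiable. -/
def IsC1 : Prop := ContDiff ℝ 1 P.f0 ∧ ∀ j, ContDiff ℝ 1 (P.f j)

/-- The gradients `g j x`, `j ∈ I(x)`, are linearly independent at each point `x` of the space. -/
def GradientsIndependent : Prop :=
  ∀ x, LinearIndependent ℝ (fun j : P.active x => P.g j x)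

/-- The matrix `B` acting on a vector of the Euclidean space. -/
def act (B : Matrix (Fin n) (Fin n) ℝ) (d : EuclideanSpace ℝ (Fin n)) :
    EuclideanSpace ℝ (Fin n) := WithLp.toLp 2 (B.mulVec d.ofLp)

/-! ### The quadratic subproblem -/

/-- Objective of the quadratic subproblem at `x` with matrix `B`. -/
def qpObj (x : EuclideanSpace ℝ (Fin n)) (B : Matrix (Fin n) (Fin n) ℝ)
    (d : EuclideanSpace ℝ (Fin n)) : ℝ :=
  inner ℝ (P.g0 x) d + (1 / 2) * inner ℝ d (act B d)

/-- Feasible set of the quadratic subproblem at `x`. -/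
def qpFeasible (x : EuclideanSpace ℝ (Fin n)) : Set (EuclideanSpace ℝ (Fin n)) :=
  {d | ∀ j, P.fbar j x + inner ℝ (P.g j x) d ≤ 0}

/-- `d` is an optimal solution of the quadratic subproblem. -/
def IsQPSolution (x : EuclideanSpace ℝ (Fin n)) (B : Matrix (Fin n) (Fin n) ℝ)
    (d : EuclideanSpace ℝ (Fin n)) : Prop :=
  d ∈ P.qpFeasible x ∧ IsMinOn (P.qpObj x B) (P.qpFeasible x) d

/-- `lam` is a KKT multiplier vector of the quadratic subproblem at `d`. -/
def IsQPMultiplier (x : EuclideanSpace ℝ (Fin n)) (B : Matrix (Fin n) (Fin n) ℝ)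
    (d : EuclideanSpace ℝ (Fin n)) (lam : Fin m → ℝ) : Prop :=
  P.g0 x + act B d + ∑ j, lam j • P.g j x = 0 ∧
    ∀ j, P.fbar j x + inner ℝ (P.g j x) d ≤ 0 ∧ 0 ≤ lam j ∧
      lam j * (P.fbar j x + inner ℝ (P.g j x) d) = 0

/-! ### The systems of linear equations -/

/-- The diagonal entries `D j`. -/
def diagEntry (x d0 : EuclideanSpace ℝ (Fin n)) (j : Fin m) : ℝ :=
  |P.fbar j x| * (|P.fbar j x + inner ℝ (P.g j x) d0| + ‖d0‖)

/-- The matrix `N` whose columns are the gradients of all constraint functions. -/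
def gradMatrix (x : EuclideanSpace ℝ (Fin n)) : Matrix (Fin n) (Fin m) ℝ :=
  Matrix.of fun i j => P.g j x i

/-- The common coefficient matrix `V = [[B, N], [Nᵀ, -D]]`. -/
def coeffMatrix (x : EuclideanSpace ℝ (Fin n)) (B : Matrix (Fin n) (Fin n) ℝ)
    (d0 : EuclideanSpace ℝ (Fin n)) : Matrix (Fin n ⊕ Fin m) (Fin n ⊕ Fin m) ℝ :=
  Matrix.fromBlocks B (P.gradMatrix x) (P.gradMatrix x).transpose
    (-Matrix.diagonal (P.diagEntry x d0))

/-- `(d, h)` solves the system `V (d, h) = (0, r)`. -/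
def SolvesSLE (x : EuclideanSpace ℝ (Fin n)) (B : Matrix (Fin n) (Fin n) ℝ)
    (d0 : EuclideanSpace ℝ (Fin n)) (r : Fin m → ℝ)
    (d : EuclideanSpace ℝ (Fin n)) (h : Fin m → ℝ) : Prop :=
  (P.coeffMatrix x B d0).mulVec (Sum.elim d.ofLp h) = Sum.elim (fun _ => (0 : ℝ)) r

end

end NCP

/-- The parameters of the algorithm with their admissible ranges. -/
structure SQPParams where
  (γ η ε θ σ ϱ ξ ζ α ρ δ τ : ℝ)
  γ_pos : 0 < γ
  γ_lt : γ < 1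
  η_pos : 0 < η
  η_lt : η < 1
  ε_pos : 0 < ε
  ε_lt : ε < 1
  θ_pos : 0 < θ
  θ_lt : θ < σ
  σ_lt : σ < 1
  ϱ_pos : 0 < ϱ
  ϱ_lt : ϱ < σ
  ξ_pos : 0 < ξ
  ζ_pos : 0 < ζ
  α_pos : 0 < α
  α_lt : α < 1 / 2
  ρ_gt : 1 < ρ
  δ_gt : 2 < δ
  τ_gt : 2 < τ
  τ_lt : τ < 3

/-- What the algorithm holds at the end of Step 1 of an iteration: the point `x`, the matrix `B`,
the solution `d0` of the quadratic subproblem and its multiplier vector `lam`. -/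
structure SQPIterate (n m : ℕ) where
  x : EuclideanSpace ℝ (Fin n)
  B : Matrix (Fin n) (Fin n) ℝ
  d0 : EuclideanSpace ℝ (Fin n)
  lam : Fin m → ℝ

namespace NCP

noncomputable section

variable {n m : ℕ} (P : NCP n m) (p : SQPParams)

/-- Step 1 at `x` with the symmetric positive definite matrix `B`: the quadratic subproblem has
been solved, with solution `d0` and multiplier vector `lam`. -/
def Step1 (s : SQPIterate n m) : Prop :=
  s.B.PosDef ∧ P.IsQPSolution s.x s.B s.d0 ∧ P.IsQPMultiplier s.x s.B s.d0 s.lam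

/-- The stopping test of Step 1. -/
def Stops (s : SQPIterate n m) : Prop := s.d0 = 0 ∧ P.phi s.x = 0

/-- The linear system of Step 2, whose solution contains the correction direction `d1`. -/
def SolvesCorrection (s : SQPIterate n m) (d1 : EuclideanSpace ℝ (Fin n)) (h1 : Fin m → ℝ) :
    Prop :=
  P.SolvesSLE s.x s.B s.d0
    (fun j => -(‖s.d0‖ ^ p.τ + P.phi s.x ^ p.σ)
      - (P.f j (s.x + s.d0) - P.f j s.x - inner ℝ (P.g j s.x) s.d0)) d1 h1

/-- The test of Step 2 with `d = d0 + d1`, which decides between Step 3 and Step 4. -/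
def Step2Test (s : SQPIterate n m) (d : EuclideanSpace ℝ (Fin n)) : Prop :=
  inner ℝ (P.g0 s.x) s.d0 ≤
    p.ζ * min (-(‖s.d0‖ ^ p.δ)) (-(‖d‖ ^ p.δ)) + p.ξ * P.phi s.x ^ p.ϱ

/-- The inequalities that are tested in Step 3 for the step length `t` along `d = d0 + d1`. -/
def Step3Test (s : SQPIterate n m) (d : EuclideanSpace ℝ (Fin n)) (t : ℝ) : Prop :=
  P.f0 (s.x + t • d) ≤ P.f0 s.x + p.α * t * inner ℝ (P.g0 s.x) s.d0
      + p.ρ * (1 - p.α) * t * P.phi s.x ^ p.θ ∧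
  (∀ j ∈ P.Iplus s.x,
    P.f j (s.x + t • d) ≤ P.phi s.x - p.α * t * (‖s.d0‖ ^ p.τ + P.phi s.x ^ p.σ)) ∧
  ∀ j ∈ P.Iminus s.x, P.f j (s.x + t • d) ≤ 0

/-- Step 3 succeeds with `t = (1/2)^i`: it is the first accepted number of the sequence
`1, 1/2, 1/4, …`, and it is not below `ε`. -/
def Step3Accepts (s : SQPIterate n m) (d : EuclideanSpace ℝ (Fin n)) (i : ℕ) : Prop :=
  p.ε ≤ (1 / 2 : ℝ) ^ i ∧ P.Step3Test p s d ((1 / 2 : ℝ) ^ i) ∧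
    ∀ l < i, ¬ P.Step3Test p s d ((1 / 2 : ℝ) ^ l)

/-- The linear system of Step 4, whose solution contains the direction `dt`. -/
def SolvesFeasDir (s : SQPIterate n m) (dt : EuclideanSpace ℝ (Fin n)) (ht : Fin m → ℝ) : Prop :=
  P.SolvesSLE s.x s.B s.d0 (fun _ => -(‖s.d0‖ + P.phi s.x ^ p.σ)) dt ht

/-- The coefficient `β` of Step 4. -/
def beta (s : SQPIterate n m) (dt : EuclideanSpace ℝ (Fin n)) : ℝ :=
  if inner ℝ (P.g0 s.x) s.d0 < inner ℝ (P.g0 s.x) dt then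
    min 1 (((p.θ - 1) * inner ℝ (P.g0 s.x) s.d0 + P.phi s.x ^ p.θ) /
      (inner ℝ (P.g0 s.x) dt - inner ℝ (P.g0 s.x) s.d0))
  else 1

/-- The direction `q = (1 - β) d0 + β dt` of Step 4. -/
def dirQ (s : SQPIterate n m) (dt : EuclideanSpace ℝ (Fin n)) : EuclideanSpace ℝ (Fin n) :=
  (1 - P.beta p s dt) • s.d0 + P.beta p s dt • dt

/-- The line search inequalities of Step 5 for the step length `t` along `q`. -/
def Step5Test (s : SQPIterate n m) (dt : EuclideanSpace ℝ (Fin n)) (t : ℝ) : Prop :=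
  P.f0 (s.x + t • P.dirQ p s dt) ≤ P.f0 s.x + p.γ * t * inner ℝ (P.g0 s.x) (P.dirQ p s dt)
      + p.ρ * (1 - p.γ) * t * P.phi s.x ^ p.θ ∧
  (∀ j ∈ P.Iplus s.x,
    P.f j (s.x + t • P.dirQ p s dt) ≤
      P.phi s.x - p.γ * t * P.beta p s dt * (‖s.d0‖ + P.phi s.x ^ p.σ)) ∧
  ∀ j ∈ P.Iminus s.x, P.f j (s.x + t • P.dirQ p s dt) ≤ 0

/-- Step 5 succeeds with `t = η^i`, the first accepted number of `1, η, η², …`. -/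
def Step5Accepts (s : SQPIterate n m) (dt : EuclideanSpace ℝ (Fin n)) (i : ℕ) : Prop :=
  P.Step5Test p s dt (p.η ^ i) ∧ ∀ l < i, ¬ P.Step5Test p s dt (p.η ^ l)

/-- Steps 2 to 6, started with the data `s`, can be carried out and produce the point `x'`. -/
def Advances (s : SQPIterate n m) (x' : EuclideanSpace ℝ (Fin n)) : Prop :=
  ∃ d1 h1, P.SolvesCorrection p s d1 h1 ∧
    ((P.Step2Test p s (s.d0 + d1) ∧
        ∃ i, P.Step3Accepts p s (s.d0 + d1) i ∧ x' = s.x + (1 / 2 : ℝ) ^ i • (s.d0 + d1)) ∨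
      ((¬ P.Step2Test p s (s.d0 + d1) ∨ ∀ i, ¬ P.Step3Accepts p s (s.d0 + d1) i) ∧
        ∃ dt ht, P.SolvesFeasDir p s dt ht ∧
          ∃ i, P.Step5Accepts p s dt i ∧ x' = s.x + p.η ^ i • P.dirQ p s dt))

/-- `s` is a run of the algorithm with `N` completed iterations (`N = ⊤` for an infinite run):
Step 1 has been carried out for the indices `k ≤ N`, and for `k < N` the stopping test failed and
Steps 2 to 6 led from iterate `k` to the next point, with an arbitrary new symmetric positive
definite matrix. The values of `s` at indices beyond `N` are irrelevant. -/
def IsRun (N : ℕ∞) (s : ℕ → SQPIterate n m) : Prop :=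
  (∀ k : ℕ, (k : ℕ∞) ≤ N → P.Step1 (s k)) ∧
    ∀ k : ℕ, (k : ℕ∞) < N → ¬ P.Stops (s k) ∧ P.Advances p (s k) (s (k + 1)).x

/-- A run that cannot be continued: it is infinite, or it is finite and no run with one more
iteration extends it (because the algorithm has stopped, or because some step cannot be
carried out). -/
def IsMaximalRun (N : ℕ∞) (s : ℕ → SQPIterate n m) : Prop :=
  P.IsRun p N s ∧
    ∀ K : ℕ, N = K → ¬ ∃ s' : ℕ → SQPIterate n m,
      P.IsRun p ((K + 1 : ℕ) : ℕ∞) s' ∧ ∀ k ≤ K, s' k = s k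

end

end NCP

/-- The matrices of a run with `N` completed iterations are uniformly positive definite. -/
def UniformlyPosDef {n m : ℕ} (N : ℕ∞) (s : ℕ → SQPIterate n m) : Prop :=
  ∃ a b : ℝ, 0 < a ∧ 0 < b ∧ ∀ k : ℕ, (k : ℕ∞) ≤ N → ∀ d : EuclideanSpace ℝ (Fin n),
    a * ‖d‖ ^ 2 ≤ inner ℝ d (NCP.act (s k).B d) ∧ inner ℝ d (NCP.act (s k).B d) ≤ b * ‖d‖ ^ 2

namespace NCP

section

open Filter Topology

variable {n m : ℕ} (P : NCP n m) (p : SQPParams)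

/-! ### The constraint violation -/

/-! Every iteration can be carried out because `0` is feasible for the quadratic subproblem, the
gradients in `I(x)` are independent, and Step 5 tests genuine descent. Coercivity gives `d0`;
independence gives a strictly feasible point, hence multipliers (`exists_isQPMultiplier`). A
diagonal entry of `D` vanishes only at indices of `I(x)`, so the coefficient matrix is nonsingular
(`det_saddleMatrix_ne_zero`). Unless the stopping test holds, `q` strictly decreases all generalized
active constraints, and `f0` up to the slack proportional to `phi ^ θ`.

For convergence, fix an ultrafilter finer than `atTop` along which `x^k` tends to `xs`. By
compactness `B_k` and `d0^k` converge too. The function `fbar j` is discontinuous, but the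
ultrafilter decides on which side of zero `f j (x^k)` lies, so `fbar j (x^k)` has a limit, and that
limit is zero only for `j ∈ I(xs)` (`exists_tendsto_fbar`). The limit system is thus nonsingular and
the directions of Step 4 converge. If the limit of `(d0^k, phi)` were not `(0, 0)`, then `beta` and
the step lengths of Step 5 would stay away from zero (`exists_uniform_step5`); in Step 3 the step
length is at least `ε` anyway.

Each iteration would then decrease a monotone quantity by a fixed amount along the ultrafilter:
`phi` as long as the points are infeasible, `f0` once a feasible point is reached, since feasibility
persists. A monotone sequence with a finite limit along the ultrafilter has vanishing decrements, a
contradiction (`IsRun.limit_eq_zero`). So `d0^k` and `phi` tend to zero, independence forces the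
multipliers to converge, and the optimality conditions of the subproblem pass to the limit
(`exists_tendsto_isKKTPair`). -/

lemma phi_le_iff {x : EuclideanSpace ℝ (Fin n)} {c : ℝ} :
    P.phi x ≤ c ↔ 0 ≤ c ∧ ∀ j, P.f j x ≤ c := by
  simp [phi, Finset.fold_max_le]

lemma phi_nonneg (x : EuclideanSpace ℝ (Fin n)) : 0 ≤ P.phi x :=
  (P.phi_le_iff.1 le_rfl).1

lemma f_le_phi (j : Fin m) (x : EuclideanSpace ℝ (Fin n)) : P.f j x ≤ P.phi x :=
  (P.phi_le_iff.1 le_rfl).2 j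

lemma continuous_phi (hf : ∀ j, Continuous (P.f j)) : Continuous P.phi := by
  suffices h : ∀ S : Finset (Fin m), Continuous fun x => S.fold max 0 (fun j => P.f j x) from
    h Finset.univ
  intro S
  induction S using Finset.induction_on with
  | empty => simpa using continuous_const
  | insert a S ha ih =>
    simp only [Finset.fold_insert ha]
    exact (hf a).max ih

lemma fbar_nonpos (j : Fin m) (x : EuclideanSpace ℝ (Fin n)) : P.fbar j x ≤ 0 := by
  unfold fbar
  split_ifs with h
  · exact h
  · linarith [P.f_le_phi j x]

lemma fbar_eq_f_of_phi_eq_zero {x : EuclideanSpace ℝ (Fin n)} (h : P.phi x = 0) (j : Fin m) :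
    P.fbar j x = P.f j x := by
  simp [fbar, h]

/-- Limits of `fbar` along an ultrafilter: only generalized active indices get the limit zero. -/
lemma exists_tendsto_fbar (hf : ∀ j, Continuous (P.f j)) {ι : Type*} {L : Ultrafilter ι}
    {x : ι → EuclideanSpace ℝ (Fin n)} {xs : EuclideanSpace ℝ (Fin n)}
    (hx : Tendsto x L (𝓝 xs)) (j : Fin m) :
    ∃ c, Tendsto (fun i => P.fbar j (x i)) L (𝓝 c) ∧ (c = 0 → j ∈ P.active xs) ∧
      (((∀ᶠ i in L, P.f j (x i) ≤ 0) ∧ c = P.f j xs) ∨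
        ((∀ᶠ i in L, 0 < P.f j (x i)) ∧ c = P.f j xs - P.phi xs)) := by
  have hfx : Tendsto (fun i => P.f j (x i)) L (𝓝 (P.f j xs)) := ((hf j).tendsto xs).comp hx
  have hphi : Tendsto (fun i => P.phi (x i)) L (𝓝 (P.phi xs)) :=
    ((P.continuous_phi hf).tendsto xs).comp hx
  rcases L.em (fun i => P.f j (x i) ≤ 0) with h | h
  · refine ⟨P.f j xs, hfx.congr' ?_, fun h0 => ?_, Or.inl ⟨h, rfl⟩⟩
    · filter_upwards [h] with i hi
      simp [fbar, hi]
    · simp [active, fbar, h0]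
  · have h' : ∀ᶠ i in L, 0 < P.f j (x i) := h.mono fun i hi => not_le.1 hi
    refine ⟨P.f j xs - P.phi xs, (hfx.sub hphi).congr' ?_, fun h0 => ?_, Or.inr ⟨h', rfl⟩⟩
    · filter_upwards [h] with i hi
      simp [fbar, hi]
    · have h0' : 0 ≤ P.f j xs := ge_of_tendsto hfx (h'.mono fun i hi => hi.le)
      have := P.phi_nonneg xs
      -- `fbar j` may jump at `xs`: if `f j xs ≤ 0`, its value there is `f j xs`, which equals `phi
      -- xs ≥ 0` and so vanishes.
      simp only [active, fbar, Set.mem_ofPred_eq]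
      split_ifs with h1 <;> linarith

/-! ### Continuity of the data -/

lemma IsC1.continuous_f {P : NCP n m} (h : P.IsC1) (j : Fin m) : Continuous (P.f j) :=
  (h.2 j).continuous

lemma continuous_gradient_of_contDiff {F : EuclideanSpace ℝ (Fin n) → ℝ} (h : ContDiff ℝ 1 F) :
    Continuous (gradient F) :=
  (InnerProductSpace.toDual ℝ _).symm.continuous.comp (h.continuous_fderiv (by simp))

lemma IsC1.continuous_g0 {P : NCP n m} (h : P.IsC1) : Continuous P.g0 :=
  continuous_gradient_of_contDiff h.1

lemma IsC1.continuous_g {P : NCP n m} (h : P.IsC1) (j : Fin m) : Continuous (P.g j) :=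
  continuous_gradient_of_contDiff (h.2 j)

/-! ### Uniform step lengths -/

lemma line_increment_le {F : EuclideanSpace ℝ (Fin n) → ℝ} (h : ContDiff ℝ 1 F)
    {x q : EuclideanSpace ℝ (Fin n)} {t c : ℝ} (ht : 0 < t)
    (hc : ∀ s, 0 ≤ s → s ≤ t → inner ℝ (gradient F (x + s • q)) q ≤ c) :
    F (x + t • q) ≤ F x + t * c := by
  have hd : ∀ s, HasDerivAt (fun s : ℝ => F (x + s • q)) (inner ℝ (gradient F (x + s • q)) q) s := by
    intro s
    have h1 : HasFDerivAt F (fderiv ℝ F (x + s • q)) (x + s • q) :=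
      ((h.differentiable (by simp)) _).hasFDerivAt
    have h2 : HasDerivAt (fun s : ℝ => x + s • q) q s := by
      simpa using ((hasDerivAt_id s).smul_const q).const_add x
    have h3 := h1.comp_hasDerivAt s h2
    have h4 : fderiv ℝ F (x + s • q) q = inner ℝ (gradient F (x + s • q)) q := by
      simp [gradient]
    rw [h4] at h3
    exact h3
  obtain ⟨s, hs, hs'⟩ := exists_hasDerivAt_eq_slope _ _ ht
    (fun s _ => (hd s).continuousAt.continuousWithinAt) (fun s _ => hd s)
  have := hc s hs.1.le hs.2.le
  rw [hs', sub_zero, div_le_iff₀ ht] at this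
  simp only [zero_smul, add_zero] at this
  linarith

/-- If `F (x i) ≤ u i` and, when this is tight in the limit, `F` decreases along the limit
direction faster than the rate `c`, then `F (x i + t • q i) ≤ u i + t * c i` for small `t`,
uniformly in `i`. -/
lemma eventually_step_le {F : EuclideanSpace ℝ (Fin n) → ℝ} (h : ContDiff ℝ 1 F)
    {ι : Type*} {L : Filter ι} {x q : ι → EuclideanSpace ℝ (Fin n)} {u c : ι → ℝ}
    {xs qs : EuclideanSpace ℝ (Fin n)} {us cs : ℝ}
    (hx : Tendsto x L (𝓝 xs)) (hq : Tendsto q L (𝓝 qs))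
    (hu : Tendsto u L (𝓝 us)) (hc : Tendsto c L (𝓝 cs))
    (hle : ∀ᶠ i in L, F (x i) ≤ u i) (hle' : F xs ≤ us)
    (htight : F xs = us → inner ℝ (gradient F xs) qs < cs) :
    ∀ᶠ z in 𝓝 (0 : ℝ) ×ˢ L, 0 < z.1 → F (x z.2 + z.1 • q z.2) ≤ u z.2 + z.1 * c z.2 := by
  have hx2 : Tendsto (fun z : ℝ × ι => x z.2) (𝓝 (0 : ℝ) ×ˢ L) (𝓝 xs) := hx.comp tendsto_snd
  have hq2 : Tendsto (fun z : ℝ × ι => q z.2) (𝓝 (0 : ℝ) ×ˢ L) (𝓝 qs) := hq.comp tendsto_snd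
  have hu2 : Tendsto (fun z : ℝ × ι => u z.2) (𝓝 (0 : ℝ) ×ˢ L) (𝓝 us) := hu.comp tendsto_snd
  have hc2 : Tendsto (fun z : ℝ × ι => c z.2) (𝓝 (0 : ℝ) ×ˢ L) (𝓝 cs) := hc.comp tendsto_snd
  have ht : Tendsto (fun z : ℝ × ι => z.1) (𝓝 (0 : ℝ) ×ˢ L) (𝓝 0) := tendsto_fst
  have hy : Tendsto (fun z : ℝ × ι => x z.2 + z.1 • q z.2) (𝓝 (0 : ℝ) ×ˢ L) (𝓝 xs) := by
    simpa using hx2.add (ht.smul hq2)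
  rcases hle'.lt_or_eq with hlt | heq
  · have h1 : Tendsto (fun z : ℝ × ι => F (x z.2 + z.1 • q z.2)) (𝓝 (0 : ℝ) ×ˢ L) (𝓝 (F xs)) :=
      (h.continuous.tendsto xs).comp hy
    have h2 : Tendsto (fun z : ℝ × ι => u z.2 + z.1 * c z.2) (𝓝 (0 : ℝ) ×ˢ L) (𝓝 us) := by
      simpa using hu2.add (ht.mul hc2)
    filter_upwards [h1.eventually_lt h2 hlt] with z hz _ using hz.le
  · have hgrad : Tendsto (fun z : ℝ × ι => inner ℝ (gradient F (x z.2 + z.1 • q z.2)) (q z.2))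
        (𝓝 (0 : ℝ) ×ˢ L) (𝓝 (inner ℝ (gradient F xs) qs)) :=
      (((continuous_gradient_of_contDiff h).tendsto xs).comp hy).inner hq2
    have hev := hgrad.eventually_lt hc2 (htight heq)
    -- The derivative bound holds on a product neighbourhood, hence at all intermediate points `s ∈
    -- [0, t]`, as the mean value theorem requires.
    obtain ⟨e, he, pb, hpb, hall⟩ := Metric.eventually_nhds_prod_iff.1 hev
    rw [Metric.eventually_nhds_prod_iff]
    refine ⟨e, he, fun i => pb i ∧ F (x i) ≤ u i, hpb.and hle, ?_⟩
    intro t hte i hi htpos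
    have hinc := line_increment_le h (x := x i) (q := q i) (c := c i) htpos (fun s hs hst => by
      have hse : dist s 0 < e := by
        rw [Real.dist_0_eq_abs, abs_of_nonneg hs]
        rw [Real.dist_0_eq_abs, abs_of_pos htpos] at hte
        linarith
      exact (hall hse hi.1).le)
    simp only
    linarith [hi.2]

/-! ### Matrices acting on the Euclidean space -/

lemma inner_act (B : Matrix (Fin n) (Fin n) ℝ) (d e : EuclideanSpace ℝ (Fin n)) :
    inner ℝ d (act B e) = d.ofLp ⬝ᵥ B.mulVec e.ofLp := by
  simp [act, EuclideanSpace.inner_eq_star_dotProduct, dotProduct_comm]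

lemma inner_act_pos {B : Matrix (Fin n) (Fin n) ℝ} (hB : B.PosDef)
    {d : EuclideanSpace ℝ (Fin n)} (hd : d ≠ 0) : 0 < inner ℝ d (act B d) := by
  rw [inner_act]
  simpa using hB.dotProduct_mulVec_pos (x := d.ofLp) (by simpa using hd)

lemma inner_act_nonneg {B : Matrix (Fin n) (Fin n) ℝ} (hB : B.PosDef)
    (d : EuclideanSpace ℝ (Fin n)) : 0 ≤ inner ℝ d (act B d) := by
  rcases eq_or_ne d 0 with rfl | hd
  · simp
  · exact (inner_act_pos hB hd).le

lemma inner_act_comm {B : Matrix (Fin n) (Fin n) ℝ} (hB : B.PosDef)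
    (d e : EuclideanSpace ℝ (Fin n)) : inner ℝ d (act B e) = inner ℝ e (act B d) := by
  have hT : B.transpose = B := by simpa [Matrix.IsHermitian] using hB.isHermitian
  rw [inner_act, inner_act, Matrix.dotProduct_mulVec, ← Matrix.mulVec_transpose, hT,
    dotProduct_comm]

lemma continuous_act : Continuous fun z : Matrix (Fin n) (Fin n) ℝ × EuclideanSpace ℝ (Fin n) =>
    act z.1 z.2 := by
  unfold act
  refine (PiLp.continuous_toLp 2 _).comp ?_
  exact continuous_fst.matrix_mulVec ((PiLp.continuous_ofLp 2 _).comp continuous_snd)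

lemma act_add (B : Matrix (Fin n) (Fin n) ℝ) (d e : EuclideanSpace ℝ (Fin n)) :
    act B (d + e) = act B d + act B e := by
  simp [act, Matrix.mulVec_add]

lemma act_smul (B : Matrix (Fin n) (Fin n) ℝ) (t : ℝ) (d : EuclideanSpace ℝ (Fin n)) :
    act B (t • d) = t • act B d := by
  simp [act, Matrix.mulVec_smul]

lemma exists_pos_mul_sq_le_inner_act {B : Matrix (Fin n) (Fin n) ℝ} (hB : B.PosDef) :
    ∃ a > 0, ∀ d : EuclideanSpace ℝ (Fin n), a * ‖d‖ ^ 2 ≤ inner ℝ d (act B d) := by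
  have hcont : Continuous fun d : EuclideanSpace ℝ (Fin n) => (inner ℝ d (act B d) : ℝ) :=
    continuous_id.inner (continuous_act.comp (continuous_const.prodMk continuous_id))
  have key : ∃ a > 0, ∀ e ∈ Metric.sphere (0 : EuclideanSpace ℝ (Fin n)) 1,
      a ≤ inner ℝ e (act B e) := by
    -- The sphere is empty exactly when `n = 0`.
    rcases (Metric.sphere (0 : EuclideanSpace ℝ (Fin n)) 1).eq_empty_or_nonempty with h | h
    · exact ⟨1, one_pos, by simp [h]⟩
    · obtain ⟨e, he, hmin⟩ := (isCompact_sphere _ _).exists_isMinOn h hcont.continuousOn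
      refine ⟨_, inner_act_pos hB (d := e) ?_, fun e' he' => hmin he'⟩
      rintro rfl
      simp at he
  obtain ⟨a, ha, hall⟩ := key
  refine ⟨a, ha, fun d => ?_⟩
  rcases eq_or_ne d 0 with rfl | hd
  · simp
  · have hn : 0 < ‖d‖ := norm_pos_iff.2 hd
    have h1 := hall (‖d‖⁻¹ • d) (by simp [norm_smul, hn.ne'])
    rw [act_smul, real_inner_smul_left, real_inner_smul_right] at h1
    have h2 : inner ℝ d (act B d) = ‖d‖ ^ 2 * (‖d‖⁻¹ * (‖d‖⁻¹ * inner ℝ d (act B d))) := by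
      field_simp
    rw [h2, mul_comm]
    gcongr

/-! ### The block systems -/

/-- The matrix `[[B, N], [Nᵀ, -D]]`, where `N` has the columns `v j` and `D` is diagonal. -/
def saddleMatrix (B : Matrix (Fin n) (Fin n) ℝ) (v : Fin m → EuclideanSpace ℝ (Fin n))
    (D : Fin m → ℝ) : Matrix (Fin n ⊕ Fin m) (Fin n ⊕ Fin m) ℝ :=
  Matrix.fromBlocks B (Matrix.of fun i j => v j i) (Matrix.of fun i j => v j i).transpose
    (-Matrix.diagonal D)

/-- Separating `D` from the point matters: limits of coefficient matrices need not be the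
coefficient matrix at the limit point, because `fbar` is discontinuous. -/
lemma coeffMatrix_eq (x : EuclideanSpace ℝ (Fin n)) (B : Matrix (Fin n) (Fin n) ℝ)
    (d0 : EuclideanSpace ℝ (Fin n)) :
    P.coeffMatrix x B d0 = saddleMatrix B (fun j => P.g j x) (P.diagEntry x d0) := rfl

lemma saddleMatrix_mulVec_eq_iff {B : Matrix (Fin n) (Fin n) ℝ}
    {v : Fin m → EuclideanSpace ℝ (Fin n)} {D : Fin m → ℝ} {d : EuclideanSpace ℝ (Fin n)}
    {h r : Fin m → ℝ} :
    (saddleMatrix B v D).mulVec (Sum.elim d.ofLp h) = Sum.elim (fun _ => (0 : ℝ)) r ↔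
      act B d + ∑ j, h j • v j = 0 ∧ ∀ j, inner ℝ (v j) d - D j * h j = r j := by
  have hinner : ∀ j, inner ℝ (v j) d = ∑ i, v j i * d i := fun j => by
    simp [EuclideanSpace.inner_eq_star_dotProduct, dotProduct, mul_comm]
  rw [saddleMatrix, Matrix.fromBlocks_mulVec]
  constructor
  · intro H
    refine ⟨?_, fun j => ?_⟩
    · ext i
      have := congrFun H (Sum.inl i)
      simpa [act, Matrix.mulVec, dotProduct, mul_comm] using this
    · have := congrFun H (Sum.inr j)
      simp [Matrix.mulVec, dotProduct] at this
      rw [hinner]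
      simp_all [Matrix.diagonal_apply]
      linarith
  · rintro ⟨h1, h2⟩
    funext k
    rcases k with i | j
    · have := congrArg (fun w : EuclideanSpace ℝ (Fin n) => w i) h1
      simpa [act, Matrix.mulVec, dotProduct, mul_comm] using this
    · have := h2 j
      rw [hinner] at this
      simp [Matrix.mulVec, dotProduct, Matrix.diagonal_apply]
      linarith

/-- Pairing the first row of a kernel equation with `d` gives `dᵀBd + ∑ D j * h j ^ 2 = 0`. So `d =
0` and `h` lives where `D` vanishes; there the first row is a linear relation between independent
vectors. -/
lemma det_saddleMatrix_ne_zero {B : Matrix (Fin n) (Fin n) ℝ} (hB : B.PosDef)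
    {v : Fin m → EuclideanSpace ℝ (Fin n)} {D : Fin m → ℝ} (hD : ∀ j, 0 ≤ D j)
    (hv : LinearIndependent ℝ fun j : {j | D j = 0} => v j) :
    (saddleMatrix B v D).det ≠ 0 := by
  intro hdet
  obtain ⟨w, hw, hw0⟩ := Matrix.exists_mulVec_eq_zero_iff.2 hdet
  set d : EuclideanSpace ℝ (Fin n) := WithLp.toLp 2 (fun i => w (Sum.inl i)) with hd
  set h : Fin m → ℝ := fun j => w (Sum.inr j) with hh
  have hwe : w = Sum.elim d.ofLp h := by
    funext k; rcases k with i | j <;> rfl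
  have h0 : Sum.elim (fun _ : Fin n => (0 : ℝ)) (fun _ : Fin m => (0 : ℝ)) = 0 := by
    funext k; rcases k with i | j <;> rfl
  rw [hwe, ← h0, saddleMatrix_mulVec_eq_iff] at hw0
  obtain ⟨h1, h2⟩ := hw0
  have h3 : inner ℝ d (act B d) + ∑ j, D j * h j ^ 2 = 0 := by
    have := congrArg (fun w => (inner ℝ d w : ℝ)) h1
    simp only [inner_add_right, inner_sum, real_inner_smul_right, inner_zero_right] at this
    rw [← this]
    congr 1
    refine Finset.sum_congr rfl fun j _ => ?_
    have := h2 j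
    rw [real_inner_comm]
    have h5 : inner ℝ (v j) d = D j * h j := by linarith
    rw [h5]; ring
  have h4 : 0 ≤ ∑ j, D j * h j ^ 2 := Finset.sum_nonneg fun j _ => mul_nonneg (hD j) (sq_nonneg _)
  have hd0 : d = 0 := by
    by_contra hne
    linarith [inner_act_pos hB hne]
  have hs : ∑ j, D j * h j ^ 2 = 0 := by linarith [inner_act_nonneg hB d]
  have hj : ∀ j, D j ≠ 0 → h j = 0 := by
    intro j hjD
    have := (Finset.sum_eq_zero_iff_of_nonneg
      (fun j _ => mul_nonneg (hD j) (sq_nonneg (h j)))).1 hs j (Finset.mem_univ j)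
    simpa [hjD] using this
  have hz : ∀ j, D j = 0 → h j = 0 := by
    have h5 : ∑ j, h j • v j = 0 := by simpa [hd0, act] using h1
    have h6 : ∑ j ∈ Finset.univ.filter (fun j => D j = 0), h j • v j = 0 := by
      rw [← h5]
      refine Finset.sum_subset (Finset.subset_univ _) fun j _ hjD => ?_
      rw [hj j (by simpa using hjD), zero_smul]
    intro j hjD
    exact (linearIndepOn_iff'.1 hv) _ h (by intro i hi; simpa using hi) h6 j (by simpa using hjD)
  apply hw
  rw [hwe, ← h0, hd0]
  congr 1
  funext j
  by_cases hjD : D j = 0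
  · exact hz j hjD
  · exact hj j hjD

lemma exists_saddleMatrix_solution {B : Matrix (Fin n) (Fin n) ℝ}
    {v : Fin m → EuclideanSpace ℝ (Fin n)} {D : Fin m → ℝ}
    (hdet : (saddleMatrix B v D).det ≠ 0) (r : Fin m → ℝ) :
    ∃ (d : EuclideanSpace ℝ (Fin n)) (h : Fin m → ℝ),
      (saddleMatrix B v D).mulVec (Sum.elim d.ofLp h) = Sum.elim (fun _ => (0 : ℝ)) r := by
  set w := (saddleMatrix B v D)⁻¹.mulVec (Sum.elim (fun _ => (0 : ℝ)) r) with hw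
  refine ⟨WithLp.toLp 2 (fun i => w (Sum.inl i)), fun j => w (Sum.inr j), ?_⟩
  have hwe : Sum.elim (fun i => w (Sum.inl i)) (fun j => w (Sum.inr j)) = w := by
    funext k; rcases k with i | j <;> rfl
  rw [hwe, hw, Matrix.mulVec_mulVec, Matrix.mul_nonsing_inv _ (isUnit_iff_ne_zero.2 hdet),
    Matrix.one_mulVec]

/-- Solutions of convergent block systems with nonsingular limit converge. -/
lemma tendsto_saddleMatrix_solution {ι : Type*} {L : Filter ι} [L.NeBot]
    {B : ι → Matrix (Fin n) (Fin n) ℝ} {v : ι → Fin m → EuclideanSpace ℝ (Fin n)}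
    {D r h : ι → Fin m → ℝ} {d : ι → EuclideanSpace ℝ (Fin n)}
    {Bs : Matrix (Fin n) (Fin n) ℝ} {vs : Fin m → EuclideanSpace ℝ (Fin n)} {Ds rs : Fin m → ℝ}
    (hB : Tendsto B L (𝓝 Bs)) (hv : Tendsto v L (𝓝 vs)) (hD : Tendsto D L (𝓝 Ds))
    (hr : Tendsto r L (𝓝 rs)) (hdet : (saddleMatrix Bs vs Ds).det ≠ 0)
    (hsol : ∀ᶠ i in L, (saddleMatrix (B i) (v i) (D i)).mulVec (Sum.elim (d i).ofLp (h i)) =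
      Sum.elim (fun _ => (0 : ℝ)) (r i)) :
    ∃ ds hs, Tendsto d L (𝓝 ds) ∧ Tendsto h L (𝓝 hs) ∧
      (saddleMatrix Bs vs Ds).mulVec (Sum.elim ds.ofLp hs) = Sum.elim (fun _ => (0 : ℝ)) rs := by
  have hM : Tendsto (fun i => saddleMatrix (B i) (v i) (D i)) L (𝓝 (saddleMatrix Bs vs Ds)) := by
    have hc : Continuous fun z : Matrix (Fin n) (Fin n) ℝ × (Fin m → EuclideanSpace ℝ (Fin n)) ×
        (Fin m → ℝ) => saddleMatrix z.1 z.2.1 z.2.2 := by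
      have hN : Continuous fun z : Matrix (Fin n) (Fin n) ℝ ×
          (Fin m → EuclideanSpace ℝ (Fin n)) × (Fin m → ℝ) =>
          (Matrix.of fun i j => z.2.1 j i : Matrix (Fin n) (Fin m) ℝ) := by
        refine continuous_matrix fun i j => ?_
        simp only [Matrix.of_apply]
        fun_prop
      exact continuous_fst.matrix_fromBlocks hN hN.matrix_transpose
        ((continuous_snd.comp continuous_snd).matrix_diagonal.neg)
    exact (hc.tendsto (Bs, vs, Ds)).comp (hB.prodMk_nhds (hv.prodMk_nhds hD))
  have hR : Tendsto (fun i => Sum.elim (fun _ : Fin n => (0 : ℝ)) (r i)) L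
      (𝓝 (Sum.elim (fun _ => (0 : ℝ)) rs)) := by
    rw [tendsto_pi_nhds]
    rintro (i | j)
    · simp
    · simpa using (tendsto_pi_nhds.1 hr) j
  have hdetL : Tendsto (fun i => (saddleMatrix (B i) (v i) (D i)).det) L
      (𝓝 (saddleMatrix Bs vs Ds).det) := ((continuous_id.matrix_det).tendsto _).comp hM
  have hinv : Tendsto (fun i => (saddleMatrix (B i) (v i) (D i))⁻¹) L
      (𝓝 (saddleMatrix Bs vs Ds)⁻¹) := by
    simp only [Matrix.inv_def, Ring.inverse_eq_inv']
    exact (hdetL.inv₀ hdet).smul (((continuous_id.matrix_adjugate).tendsto _).comp hM)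
  set w := (saddleMatrix Bs vs Ds)⁻¹.mulVec (Sum.elim (fun _ => (0 : ℝ)) rs) with hw
  have hmv : Tendsto (fun i => Sum.elim (d i).ofLp (h i)) L (𝓝 w) := by
    have hc : Continuous fun z : Matrix (Fin n ⊕ Fin m) (Fin n ⊕ Fin m) ℝ × (Fin n ⊕ Fin m → ℝ) =>
        z.1.mulVec z.2 := continuous_fst.matrix_mulVec continuous_snd
    refine ((hc.tendsto (_, _)).comp (hinv.prodMk_nhds hR)).congr' ?_
    filter_upwards [hsol, hdetL.eventually_ne hdet] with i hi hdi
    simp only [Function.comp]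
    rw [← hi, Matrix.mulVec_mulVec, Matrix.nonsing_inv_mul _ (isUnit_iff_ne_zero.2 hdi),
      Matrix.one_mulVec]
  rw [tendsto_pi_nhds] at hmv
  have hwe : Sum.elim (fun i => w (Sum.inl i)) (fun j => w (Sum.inr j)) = w := by
    funext k; rcases k with i | j <;> rfl
  refine ⟨WithLp.toLp 2 (fun i => w (Sum.inl i)), fun j => w (Sum.inr j), ?_, ?_, ?_⟩
  · have : Tendsto (fun i => (d i).ofLp) L (𝓝 fun i => w (Sum.inl i)) := by
      rw [tendsto_pi_nhds]
      exact fun i => hmv (Sum.inl i)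
    exact ((PiLp.continuous_toLp 2 _).tendsto _).comp this
  · rw [tendsto_pi_nhds]
    exact fun j => hmv (Sum.inr j)
  · rw [hwe, hw, Matrix.mulVec_mulVec, Matrix.mul_nonsing_inv _ (isUnit_iff_ne_zero.2 hdet),
      Matrix.one_mulVec]

/-- If `c ≠ 0`, the second factor vanishes, so `d = 0` and then `|c| = 0`. The summand `‖d‖`
excludes indices where only the linearized constraint is active. -/
lemma eq_zero_of_diag_eq_zero {c : ℝ} {v d : EuclideanSpace ℝ (Fin n)}
    (h : |c| * (|c + inner ℝ v d| + ‖d‖) = 0) : c = 0 := by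
  by_contra hc
  have h1 : |c + inner ℝ v d| + ‖d‖ = 0 := by simpa [hc] using h
  have h2 : d = 0 := norm_eq_zero.1 (by linarith [abs_nonneg (c + inner ℝ v d), norm_nonneg d])
  simp [h2, hc] at h1

lemma diagEntry_nonneg (x d0 : EuclideanSpace ℝ (Fin n)) (j : Fin m) :
    0 ≤ P.diagEntry x d0 j := by
  unfold diagEntry
  positivity

lemma det_coeffMatrix_ne_zero {P : NCP n m} (hLI : P.GradientsIndependent)
    (x : EuclideanSpace ℝ (Fin n)) {B : Matrix (Fin n) (Fin n) ℝ} (hB : B.PosDef)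
    (d0 : EuclideanSpace ℝ (Fin n)) : (P.coeffMatrix x B d0).det ≠ 0 := by
  rw [coeffMatrix_eq]
  refine det_saddleMatrix_ne_zero hB (P.diagEntry_nonneg x d0) ?_
  have hact : LinearIndepOn ℝ (fun j => P.g j x) (P.active x) := hLI x
  refine hact.mono fun j hj => ?_
  have hj' : P.diagEntry x d0 j = 0 := hj
  exact eq_zero_of_diag_eq_zero hj'

lemma exists_solvesSLE {P : NCP n m} (hLI : P.GradientsIndependent)
    (x : EuclideanSpace ℝ (Fin n)) {B : Matrix (Fin n) (Fin n) ℝ} (hB : B.PosDef)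
    (d0 : EuclideanSpace ℝ (Fin n)) (r : Fin m → ℝ) : ∃ d h, P.SolvesSLE x B d0 r d h :=
  exists_saddleMatrix_solution (det_coeffMatrix_ne_zero hLI x hB d0) r

/-! ### The quadratic subproblem -/

/-- The linearized constraints have a strictly feasible point. -/
lemma exists_strictly_feasible {P : NCP n m} (hLI : P.GradientsIndependent)
    (x : EuclideanSpace ℝ (Fin n)) :
    ∃ d, ∀ j, P.fbar j x + inner ℝ (P.g j x) d < 0 := by
  -- With `d0 = 0` the diagonal entry vanishes wherever `fbar` does, so `u` has slope `-1` along
  -- every active gradient; the other constraints have room for a small multiple of `u`.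
  obtain ⟨u, h, hu⟩ := exists_solvesSLE hLI x Matrix.PosDef.one 0 (fun _ => -1)
  rw [SolvesSLE, coeffMatrix_eq, saddleMatrix_mulVec_eq_iff] at hu
  have hev : ∀ j, ∀ᶠ t : ℝ in 𝓝[>] 0, P.fbar j x + inner ℝ (P.g j x) (t • u) < 0 := by
    intro j
    rcases (P.fbar_nonpos j x).lt_or_eq with hlt | heq
    · have hc : Tendsto (fun t : ℝ => P.fbar j x + inner ℝ (P.g j x) (t • u)) (𝓝 0)
          (𝓝 (P.fbar j x + inner ℝ (P.g j x) ((0 : ℝ) • u))) := by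
        apply Continuous.tendsto
        fun_prop
      rw [zero_smul, inner_zero_right, add_zero] at hc
      exact (hc.eventually_lt_const hlt).filter_mono nhdsWithin_le_nhds
    · have h1 := hu.2 j
      have h2 : P.diagEntry x 0 j = 0 := by simp [diagEntry, heq]
      rw [h2, zero_mul, sub_zero] at h1
      filter_upwards [self_mem_nhdsWithin] with t ht
      rw [real_inner_smul_right, h1, heq]
      have : 0 < t := ht
      linarith
  obtain ⟨t, ht⟩ := (eventually_all.2 hev).exists
  exact ⟨t • u, ht⟩

lemma exists_isQPSolution (x : EuclideanSpace ℝ (Fin n)) {B : Matrix (Fin n) (Fin n) ℝ}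
    (hB : B.PosDef) : ∃ d, P.IsQPSolution x B d := by
  obtain ⟨a, ha, hall⟩ := exists_pos_mul_sq_le_inner_act hB
  have hcont : Continuous (P.qpObj x B) := by
    unfold qpObj
    exact (continuous_const.inner continuous_id).add (continuous_const.mul
      (continuous_id.inner (continuous_act.comp (continuous_const.prodMk continuous_id))))
  have hclosed : IsClosed (P.qpFeasible x) := by
    have : P.qpFeasible x = ⋂ j, {d | P.fbar j x + inner ℝ (P.g j x) d ≤ 0} := by
      ext d; simp [qpFeasible]
    rw [this]
    exact isClosed_iInter fun j => isClosed_le (by fun_prop) continuous_const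
  have h0 : (0 : EuclideanSpace ℝ (Fin n)) ∈ P.qpFeasible x := fun j => by
    simpa using P.fbar_nonpos j x
  refine hcont.continuousOn.exists_isMinOn' hclosed h0 ?_
  refine Eventually.filter_mono inf_le_left ?_
  -- Beyond the radius `2‖g0‖/a` the quadratic term dominates, so the objective is at least its
  -- value `0` at the origin.
  filter_upwards [(tendsto_norm_cocompact_atTop (E := EuclideanSpace ℝ (Fin n))).eventually_ge_atTop
    (2 * ‖P.g0 x‖ / a)] with d hd
  rw [div_le_iff₀ ha] at hd
  have h1 := abs_le.1 (abs_real_inner_le_norm (P.g0 x) d)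
  have h2 := hall d
  have h3 := mul_le_mul_of_nonneg_right hd (norm_nonneg d)
  simp only [qpObj, inner_zero_right, inner_zero_left, mul_zero, add_zero]
  nlinarith [h1.1]

/-- Gordan's alternative for a finite family of vectors. -/
lemma exists_inner_neg_or_exists_weights {ι E : Type*} [Fintype ι] [NormedAddCommGroup E]
    [InnerProductSpace ℝ E] [CompleteSpace E] (v : ι → E) :
    (∃ p, ∀ i, inner ℝ (v i) p < 0) ∨
      ∃ w : ι → ℝ, (∀ i, 0 ≤ w i) ∧ ∑ i, w i = 1 ∧ ∑ i, w i • v i = 0 := by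
  by_cases h : (0 : E) ∈ convexHull ℝ (Set.range v)
  · right
    have hsub : convexHull ℝ (Set.range v) ⊆ Fintype.linearCombination ℝ v '' stdSimplex ℝ ι := by
      classical
      refine convexHull_min ?_ ((convex_stdSimplex ℝ ι).linear_image _)
      rintro _ ⟨i, rfl⟩
      exact ⟨Pi.single i 1, single_mem_stdSimplex ℝ i, by simp⟩
    obtain ⟨w, hw, hw0⟩ := hsub h
    exact ⟨w, hw.1, hw.2, by simpa [Fintype.linearCombination_apply] using hw0⟩
  · left
    obtain ⟨l, u, hl, hu⟩ := geometric_hahn_banach_closed_point (convex_convexHull ℝ _)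
      ((Set.finite_range v).isClosed_convexHull ℝ) h
    refine ⟨(InnerProductSpace.toDual ℝ E).symm l, fun i => ?_⟩
    rw [real_inner_comm, InnerProductSpace.toDual_symm_apply]
    have := hl (v i) (subset_convexHull ℝ _ ⟨i, rfl⟩)
    rw [map_zero] at hu
    linarith

/-- Gordan's alternative for `G`, the objective's gradient at `d`, and the active constraint
gradients: either there is a feasible descent direction, against optimality, or there are Fritz John
weights. A strictly feasible point makes the weight of `G` (index `none`) positive, and one divides
by it. -/
lemma exists_isQPMultiplier {P : NCP n m} (hLI : P.GradientsIndependent)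
    {x : EuclideanSpace ℝ (Fin n)} {B : Matrix (Fin n) (Fin n) ℝ} (hB : B.PosDef)
    {d : EuclideanSpace ℝ (Fin n)} (hd : P.IsQPSolution x B d) :
    ∃ lam, P.IsQPMultiplier x B d lam := by
  classical
  obtain ⟨hfeas, hmin⟩ := hd
  obtain ⟨ds, hds⟩ := exists_strictly_feasible hLI x
  set A : Set (Fin m) := {j | P.fbar j x + inner ℝ (P.g j x) d = 0} with hA
  set G := P.g0 x + act B d with hG
  rcases exists_inner_neg_or_exists_weights
    (fun o : Option A => o.elim G fun j => P.g j x) with ⟨q, hq⟩ | ⟨w, hw0, hw1, hw⟩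
  · exfalso
    have hq0 : inner ℝ G q < 0 := hq none
    have hev : ∀ j, ∀ᶠ t : ℝ in 𝓝[>] 0, P.fbar j x + inner ℝ (P.g j x) (d + t • q) ≤ 0 := by
      intro j
      by_cases hj : j ∈ A
      · have h1 : inner ℝ (P.g j x) q < 0 := hq (some ⟨j, hj⟩)
        have h2 : P.fbar j x + inner ℝ (P.g j x) d = 0 := hj
        filter_upwards [self_mem_nhdsWithin] with t ht
        have ht' : (0 : ℝ) < t := ht
        rw [inner_add_right, real_inner_smul_right]
        nlinarith
      · have hlt : P.fbar j x + inner ℝ (P.g j x) d < 0 := lt_of_le_of_ne (hfeas j) hj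
        have hc : Tendsto (fun t : ℝ => P.fbar j x + inner ℝ (P.g j x) (d + t • q)) (𝓝 0)
            (𝓝 (P.fbar j x + inner ℝ (P.g j x) (d + (0 : ℝ) • q))) := by
          apply Continuous.tendsto
          fun_prop
        rw [zero_smul, add_zero] at hc
        exact ((hc.eventually_lt_const hlt).filter_mono nhdsWithin_le_nhds).mono fun t h => h.le
    have hev2 : ∀ᶠ t : ℝ in 𝓝[>] 0, inner ℝ G q + t * ((1 / 2) * inner ℝ q (act B q)) < 0 := by
      have hc : Tendsto (fun t : ℝ => inner ℝ G q + t * ((1 / 2) * inner ℝ q (act B q))) (𝓝 0)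
          (𝓝 (inner ℝ G q + 0 * ((1 / 2) * inner ℝ q (act B q)))) := by
        apply Continuous.tendsto
        fun_prop
      rw [zero_mul, add_zero] at hc
      exact (hc.eventually_lt_const hq0).filter_mono nhdsWithin_le_nhds
    obtain ⟨t, ⟨ht1, ht2⟩, ht3⟩ :=
      (((eventually_all.2 hev).and hev2).and self_mem_nhdsWithin).exists
    have ht : (0 : ℝ) < t := ht3
    have h1 : P.qpObj x B d ≤ P.qpObj x B (d + t • q) := hmin ht1
    have h2 : P.qpObj x B (d + t • q) = P.qpObj x B d +
        t * (inner ℝ G q + t * ((1 / 2) * inner ℝ q (act B q))) := by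
      have h3 := inner_act_comm hB d q
      have h4 : inner ℝ (act B d) q = inner ℝ q (act B d) := real_inner_comm _ _
      simp only [qpObj, hG, act_add, act_smul, inner_add_left, inner_add_right,
        real_inner_smul_left, real_inner_smul_right, h3, h4]
      ring
    nlinarith
  · rw [Fintype.sum_option] at hw hw1
    simp only [Option.elim] at hw
    have hwn : 0 < w none := by
      rcases (hw0 none).lt_or_eq with h | h
      · exact h
      exfalso
      rw [← h] at hw hw1
      rw [zero_smul, zero_add] at hw
      -- Without `G`, pairing the relation with `ds - d`, a strict descent direction for every
      -- active constraint, kills all the weights, which sum to one.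
      have h1 : ∑ j : A, w (some j) * inner ℝ (P.g j x) (ds - d) = 0 := by
        have := congrArg (fun y => (inner ℝ y (ds - d) : ℝ)) hw
        simpa only [sum_inner, real_inner_smul_left, inner_zero_left] using this
      have hneg : ∀ j : A, inner ℝ (P.g j x) (ds - d) < 0 := fun j => by
        have h2 := hds j
        have h3 : P.fbar j x + inner ℝ (P.g j x) d = 0 := j.2
        rw [inner_sub_right]
        linarith
      have h4 : ∀ j : A, w (some j) = 0 := by
        intro j
        have h5 := (Finset.sum_eq_zero_iff_of_nonpos (fun j _ =>
          mul_nonpos_of_nonneg_of_nonpos (hw0 (some j)) (hneg j).le)).1 h1 j (Finset.mem_univ j)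
        rcases mul_eq_zero.1 h5 with h6 | h6
        · exact h6
        · exact absurd h6 (hneg j).ne
      simp [h4] at hw1
    refine ⟨fun j => if hj : j ∈ A then w (some ⟨j, hj⟩) / w none else 0, ?_, fun j => ⟨hfeas j, ?_, ?_⟩⟩
    · have hsum : ∑ j, (if hj : j ∈ A then w (some ⟨j, hj⟩) / w none else 0) • P.g j x =
          (w none)⁻¹ • ∑ j : A, w (some j) • P.g j x := by
        rw [Finset.smul_sum, ← Finset.sum_subset (Finset.subset_univ
          (Finset.univ.filter fun j => j ∈ A)) fun j _ hj => by simp_all,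
          Finset.sum_subtype _ (p := fun j => j ∈ A) (by simp)]
        refine Finset.sum_congr rfl fun j _ => ?_
        rw [dif_pos j.2, smul_smul, div_eq_inv_mul]
      rw [hsum]
      have : ∑ j : A, w (some j) • P.g j x = -(w none • G) := by
        rw [eq_neg_iff_add_eq_zero, add_comm]; exact hw
      rw [this, smul_neg, smul_smul, inv_mul_cancel₀ hwn.ne', one_smul]
      exact add_neg_cancel G
    · dsimp only
      split_ifs with hj
      · exact div_nonneg (hw0 _) hwn.le
      · exact le_rfl
    · dsimp only
      split_ifs with hj
      · have h3 : P.fbar j x + inner ℝ (P.g j x) d = 0 := hj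
        rw [h3, mul_zero]
      · rw [zero_mul]

lemma exists_step1 {P : NCP n m} (hLI : P.GradientsIndependent)
    (x : EuclideanSpace ℝ (Fin n)) {B : Matrix (Fin n) (Fin n) ℝ} (hB : B.PosDef) :
    ∃ s : SQPIterate n m, P.Step1 s ∧ s.x = x ∧ s.B = B := by
  obtain ⟨d, hd⟩ := P.exists_isQPSolution x hB
  obtain ⟨lam, hlam⟩ := exists_isQPMultiplier hLI hB hd
  exact ⟨⟨x, B, d, lam⟩, ⟨hB, hd, hlam⟩, rfl, rfl⟩

/-! ### Single iterations -/

/-- Pair stationarity with `d0`: complementarity turns `lam j * ⟪g j, d0⟫` into `-lam j * fbar j ≥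
0`. -/
lemma Step1.inner_g0_d0_le {P : NCP n m} {s : SQPIterate n m} (h : P.Step1 s) :
    inner ℝ (P.g0 s.x) s.d0 ≤ -inner ℝ s.d0 (act s.B s.d0) := by
  obtain ⟨-, -, h1, h2⟩ := h
  have h3 := congrArg (fun y => (inner ℝ y s.d0 : ℝ)) h1
  simp only [inner_add_left, sum_inner, real_inner_smul_left, inner_zero_left] at h3
  have h4 : 0 ≤ ∑ j, s.lam j * inner ℝ (P.g j s.x) s.d0 := by
    refine Finset.sum_nonneg fun j _ => ?_
    have h5 := (h2 j).2.2
    have h6 := mul_nonpos_of_nonneg_of_nonpos (h2 j).2.1 (P.fbar_nonpos j s.x)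
    linarith
  rw [real_inner_comm] at h3 ⊢
  rw [real_inner_comm (act s.B s.d0)]
  linarith

lemma Step1.inner_g0_d0_nonpos {P : NCP n m} {s : SQPIterate n m} (h : P.Step1 s) :
    inner ℝ (P.g0 s.x) s.d0 ≤ 0 :=
  h.inner_g0_d0_le.trans (neg_nonpos.2 (inner_act_nonneg h.1 _))

lemma beta_le_one (s : SQPIterate n m) (dt : EuclideanSpace ℝ (Fin n)) : P.beta p s dt ≤ 1 := by
  unfold beta
  split_ifs
  · exact min_le_left _ _
  · exact le_rfl

/-- A lower bound without case distinction, whose denominator never vanishes, so that it passes to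
limits. -/
lemma Step1.min_le_beta {P : NCP n m} {s : SQPIterate n m} (h : P.Step1 s)
    (dt : EuclideanSpace ℝ (Fin n)) :
    min 1 (((p.θ - 1) * inner ℝ (P.g0 s.x) s.d0 + P.phi s.x ^ p.θ) /
      (|inner ℝ (P.g0 s.x) dt - inner ℝ (P.g0 s.x) s.d0| + 1)) ≤ P.beta p s dt := by
  unfold beta
  split_ifs with hlt
  · have h1 : 0 < inner ℝ (P.g0 s.x) dt - inner ℝ (P.g0 s.x) s.d0 := sub_pos.2 hlt
    rw [abs_of_pos h1]
    refine min_le_min le_rfl (div_le_div_of_nonneg_left ?_ h1 (by linarith))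
    have h2 := h.inner_g0_d0_nonpos
    have h3 := Real.rpow_nonneg (P.phi_nonneg s.x) p.θ
    have h4 : p.θ < 1 := p.θ_lt.trans p.σ_lt
    nlinarith
  · exact min_le_left _ _

lemma Step1.beta_nonneg {P : NCP n m} {s : SQPIterate n m} (h : P.Step1 s)
    (dt : EuclideanSpace ℝ (Fin n)) : 0 ≤ P.beta p s dt := by
  refine le_trans ?_ (h.min_le_beta p dt)
  refine le_min zero_le_one (div_nonneg ?_ (by positivity))
  have h2 := h.inner_g0_d0_nonpos
  have h3 := Real.rpow_nonneg (P.phi_nonneg s.x) p.θ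
  have h4 : p.θ < 1 := p.θ_lt.trans p.σ_lt
  nlinarith

/-- The quotient in `beta` is the coefficient at which this bound becomes an equality. In the other
case `β = 1` and `⟪g0, dt⟫ ≤ ⟪g0, d0⟫ ≤ θ * ⟪g0, d0⟫`. -/
lemma Step1.inner_g0_dirQ_le {P : NCP n m} {s : SQPIterate n m} (h : P.Step1 s)
    (dt : EuclideanSpace ℝ (Fin n)) :
    inner ℝ (P.g0 s.x) (P.dirQ p s dt) ≤
      p.θ * inner ℝ (P.g0 s.x) s.d0 + P.phi s.x ^ p.θ := by
  have h2 := h.inner_g0_d0_nonpos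
  have h3 := Real.rpow_nonneg (P.phi_nonneg s.x) p.θ
  have h4 : p.θ < 1 := p.θ_lt.trans p.σ_lt
  simp only [dirQ, inner_add_right, real_inner_smul_right]
  unfold beta
  split_ifs with hlt
  · have h1 : 0 < inner ℝ (P.g0 s.x) dt - inner ℝ (P.g0 s.x) s.d0 := sub_pos.2 hlt
    have h5 := (le_div_iff₀ h1).1 (min_le_right 1
      (((p.θ - 1) * inner ℝ (P.g0 s.x) s.d0 + P.phi s.x ^ p.θ) /
        (inner ℝ (P.g0 s.x) dt - inner ℝ (P.g0 s.x) s.d0)))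
    linarith
  · have := not_lt.1 hlt
    nlinarith

lemma tendsto_phi_rpow {P : NCP n m} (hC1 : P.IsC1) {ι : Type*} {L : Filter ι}
    {x : ι → EuclideanSpace ℝ (Fin n)} {xs : EuclideanSpace ℝ (Fin n)}
    (hx : Tendsto x L (𝓝 xs)) {e : ℝ} (he : 0 < e) :
    Tendsto (fun i => P.phi (x i) ^ e) L (𝓝 (P.phi xs ^ e)) :=
  (((P.continuous_phi hC1.continuous_f).tendsto xs).comp hx).rpow_const (Or.inr he.le)

set_option maxHeartbeats 1000000 in
/-- In the limit, the stopping criterion being violated, the step lengths of Step 5 and the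
coefficients `beta` stay away from zero. -/
theorem exists_uniform_step5 {P : NCP n m} {p : SQPParams} (hC1 : P.IsC1)
    (hLI : P.GradientsIndependent) {ι : Type*} {L : Ultrafilter ι} {s : ι → SQPIterate n m}
    {dt : ι → EuclideanSpace ℝ (Fin n)} {ht : ι → Fin m → ℝ}
    {xs ds : EuclideanSpace ℝ (Fin n)} {Bs : Matrix (Fin n) (Fin n) ℝ}
    (hstep : ∀ᶠ i in L, P.Step1 (s i)) (hx : Tendsto (fun i => (s i).x) L (𝓝 xs))
    (hB : Tendsto (fun i => (s i).B) L (𝓝 Bs)) (hBs : Bs.PosDef)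
    (hd0 : Tendsto (fun i => (s i).d0) L (𝓝 ds)) (hne : ds ≠ 0 ∨ P.phi xs ≠ 0)
    (hsol : ∀ᶠ i in L, P.SolvesFeasDir p (s i) (dt i) (ht i)) :
    (∃ b > 0, ∀ᶠ i in L, b ≤ P.beta p (s i) (dt i)) ∧
      ∃ T > 0, ∀ᶠ i in L, ∀ t, 0 < t → t ≤ T → P.Step5Test p (s i) (dt i) t := by
  have hθ1 : p.θ < 1 := p.θ_lt.trans p.σ_lt
  have hσ0 : 0 < p.σ := p.θ_pos.trans p.θ_lt
  have hf := hC1.continuous_f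
  choose c hc hact hbr using fun j => P.exists_tendsto_fbar hf hx j
  have hg0 : Tendsto (fun i => P.g0 (s i).x) L (𝓝 (P.g0 xs)) :=
    (hC1.continuous_g0.tendsto xs).comp hx
  have hg : ∀ j, Tendsto (fun i => P.g j (s i).x) L (𝓝 (P.g j xs)) := fun j =>
    ((hC1.continuous_g j).tendsto xs).comp hx
  have hphi : Tendsto (fun i => P.phi (s i).x) L (𝓝 (P.phi xs)) :=
    ((P.continuous_phi hf).tendsto xs).comp hx
  have hphiθ := tendsto_phi_rpow hC1 hx p.θ_pos
  have hphiσ := tendsto_phi_rpow hC1 hx hσ0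
  have hphi0 := P.phi_nonneg xs
  have hphiθ0 := Real.rpow_nonneg hphi0 p.θ
  have hphiσ0 := Real.rpow_nonneg hphi0 p.σ
  set ω := ‖ds‖ + P.phi xs ^ p.σ with hω
  have hωlim : Tendsto (fun i => ‖(s i).d0‖ + P.phi (s i).x ^ p.σ) L (𝓝 ω) := hd0.norm.add hphiσ
  have hωpos : 0 < ω := by
    rcases hne with h | h
    · linarith [norm_pos_iff.2 h]
    · linarith [norm_nonneg ds, Real.rpow_pos_of_pos (lt_of_le_of_ne hphi0 h.symm) p.σ]
  have hgd0 : inner ℝ (P.g0 xs) ds ≤ -inner ℝ ds (act Bs ds) := by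
    refine le_of_tendsto_of_tendsto (hg0.inner hd0)
      (hd0.inner ((continuous_act.tendsto (Bs, ds)).comp (hB.prodMk_nhds hd0))).neg ?_
    filter_upwards [hstep] with i hi using hi.inner_g0_d0_le
  have hgd0' : inner ℝ (P.g0 xs) ds ≤ 0 := by linarith [inner_act_nonneg hBs ds]
  -- Both terms are nonnegative; the first is positive if `ds ≠ 0`, the second if `phi xs ≠ 0`.
  have hpos : ∀ κ κ' : ℝ, 0 < κ → 0 < κ' →
      0 < κ * (-inner ℝ (P.g0 xs) ds) + κ' * P.phi xs ^ p.θ := by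
    intro κ κ' hκ hκ'
    have h1 : 0 ≤ κ' * P.phi xs ^ p.θ := by positivity
    have h2 : 0 ≤ κ * (-inner ℝ (P.g0 xs) ds) := mul_nonneg hκ.le (by linarith)
    rcases hne with h | h
    · have : 0 < κ * (-inner ℝ (P.g0 xs) ds) := mul_pos hκ (by linarith [inner_act_pos hBs h])
      linarith
    · have : 0 < κ' * P.phi xs ^ p.θ :=
        mul_pos hκ' (Real.rpow_pos_of_pos (lt_of_le_of_ne hphi0 h.symm) p.θ)
      linarith
  -- convergence of the directions of Step 4
  set Ds : Fin m → ℝ := fun j => |c j| * (|c j + inner ℝ (P.g j xs) ds| + ‖ds‖) with hDs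
  have hDlim : Tendsto (fun i => P.diagEntry (s i).x (s i).d0) L (𝓝 Ds) := by
    rw [tendsto_pi_nhds]
    intro j
    exact (hc j).abs.mul (((hc j).add ((hg j).inner hd0)).abs.add hd0.norm)
  have hdet : (saddleMatrix Bs (fun j => P.g j xs) Ds).det ≠ 0 := by
    refine det_saddleMatrix_ne_zero hBs (fun j => by positivity) ?_
    have hI : LinearIndepOn ℝ (fun j => P.g j xs) (P.active xs) := hLI xs
    refine hI.mono fun j hj => ?_
    have hj' : Ds j = 0 := hj
    exact hact j (eq_zero_of_diag_eq_zero hj')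
  obtain ⟨dts, hts, hdtlim, -, hlimsol⟩ := tendsto_saddleMatrix_solution (L := (L : Filter ι))
    (r := fun i _ => -(‖(s i).d0‖ + P.phi (s i).x ^ p.σ)) (rs := fun _ => -ω)
    hB (tendsto_pi_nhds.2 hg) hDlim (tendsto_pi_nhds.2 fun _ => hωlim.neg) hdet hsol
  have hrow : ∀ j, c j = 0 → inner ℝ (P.g j xs) dts = -ω := by
    intro j hj
    have := (saddleMatrix_mulVec_eq_iff.1 hlimsol).2 j
    simpa [hDs, hj] using this
  -- the coefficients `beta`
  have hβlow : ∃ b > 0, ∀ᶠ i in L, b ≤ P.beta p (s i) (dt i) := by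
    have hlim : Tendsto (fun i => min 1 (((p.θ - 1) * inner ℝ (P.g0 (s i).x) (s i).d0 +
        P.phi (s i).x ^ p.θ) / (|inner ℝ (P.g0 (s i).x) (dt i) -
          inner ℝ (P.g0 (s i).x) (s i).d0| + 1))) L
        (𝓝 (min 1 (((p.θ - 1) * inner ℝ (P.g0 xs) ds + P.phi xs ^ p.θ) /
          (|inner ℝ (P.g0 xs) dts - inner ℝ (P.g0 xs) ds| + 1)))) := by
      refine tendsto_const_nhds.min (Tendsto.div
        ((tendsto_const_nhds.mul (hg0.inner hd0)).add hphiθ)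
        (((hg0.inner hdtlim).sub (hg0.inner hd0)).abs.add tendsto_const_nhds) ?_)
      positivity
    set b := min 1 (((p.θ - 1) * inner ℝ (P.g0 xs) ds + P.phi xs ^ p.θ) /
          (|inner ℝ (P.g0 xs) dts - inner ℝ (P.g0 xs) ds| + 1)) with hb
    have hbpos : 0 < b := by
      refine lt_min one_pos (div_pos ?_ (by positivity))
      have := hpos (1 - p.θ) 1 (by linarith) one_pos
      linarith
    refine ⟨b / 2, half_pos hbpos, ?_⟩
    filter_upwards [hlim.eventually_const_lt (half_lt_self hbpos), hstep] with i hi1 hi2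
    exact hi1.le.trans (hi2.min_le_beta p (dt i))
  refine ⟨hβlow, ?_⟩
  obtain ⟨b, hb, hβb⟩ := hβlow
  -- The formula for `beta` need not be continuous, but its values lie in the compact interval `[b,
  -- 1]`.
  obtain ⟨β, ⟨hβ1, hβ2⟩, hβlim⟩ : ∃ β ∈ Set.Icc b 1,
      Tendsto (fun i => P.beta p (s i) (dt i)) L (𝓝 β) := by
    have hmem : Set.Icc b 1 ∈ L.map (fun i => P.beta p (s i) (dt i)) :=
      hβb.mono fun i hi => ⟨hi, P.beta_le_one p (s i) (dt i)⟩
    exact isCompact_Icc.ultrafilter_le_nhds' _ hmem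
  have hβpos : 0 < β := hb.trans_le hβ1
  set qs := (1 - β) • ds + β • dts with hqs
  have hq : Tendsto (fun i => P.dirQ p (s i) (dt i)) L (𝓝 qs) :=
    ((tendsto_const_nhds.sub hβlim).smul hd0).add (hβlim.smul hdtlim)
  have hg0q : inner ℝ (P.g0 xs) qs ≤ p.θ * inner ℝ (P.g0 xs) ds + P.phi xs ^ p.θ := by
    refine le_of_tendsto_of_tendsto (hg0.inner hq)
      ((tendsto_const_nhds.mul (hg0.inner hd0)).add hphiθ) ?_
    filter_upwards [hstep] with i hi using hi.inner_g0_dirQ_le p (dt i)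
  have hgjd : ∀ j, c j + inner ℝ (P.g j xs) ds ≤ 0 := by
    intro j
    refine le_of_tendsto ((hc j).add ((hg j).inner hd0)) ?_
    filter_upwards [hstep] with i hi using (hi.2.2.2 j).1
  have hgjq : ∀ j, c j = 0 → inner ℝ (P.g j xs) qs ≤ -(β * ω) := by
    intro j hj
    have h1 := hgjd j
    rw [hj, zero_add] at h1
    rw [hqs, inner_add_right, real_inner_smul_right, real_inner_smul_right, hrow j hj]
    nlinarith
  have hβω : 0 < β * ω := mul_pos hβpos hωpos
  -- the inequalities of Step 5
  have hobj : ∀ᶠ z in 𝓝 (0 : ℝ) ×ˢ (L : Filter ι), 0 < z.1 →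
      P.f0 ((s z.2).x + z.1 • P.dirQ p (s z.2) (dt z.2)) ≤ P.f0 (s z.2).x +
        z.1 * (p.γ * inner ℝ (P.g0 (s z.2).x) (P.dirQ p (s z.2) (dt z.2)) +
          p.ρ * (1 - p.γ) * P.phi (s z.2).x ^ p.θ) := by
    -- Because `ρ > 1`, `⟪g0, q⟫ - ρ * phi ^ θ ≤ θ * ⟪g0, d0⟫ - (ρ - 1) * phi ^ θ < 0` in the limit;
    -- multiply by `1 - γ`.
    have hlt : inner ℝ (gradient P.f0 xs) qs <
        p.γ * inner ℝ (P.g0 xs) qs + p.ρ * (1 - p.γ) * P.phi xs ^ p.θ := by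
      change inner ℝ (P.g0 xs) qs < _
      have h1 := hpos p.θ (p.ρ - 1) p.θ_pos (by linarith [p.ρ_gt])
      have h2 : inner ℝ (P.g0 xs) qs - p.ρ * P.phi xs ^ p.θ < 0 := by linarith
      have h3 := mul_neg_of_pos_of_neg (show (0 : ℝ) < 1 - p.γ by linarith [p.γ_lt]) h2
      linarith
    have hclim : Tendsto (fun i => p.γ * inner ℝ (P.g0 (s i).x) (P.dirQ p (s i) (dt i)) +
          p.ρ * (1 - p.γ) * P.phi (s i).x ^ p.θ) L
        (𝓝 (p.γ * inner ℝ (P.g0 xs) qs + p.ρ * (1 - p.γ) * P.phi xs ^ p.θ)) :=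
      ((hg0.inner hq).const_mul _).add (hphiθ.const_mul _)
    have hulim : Tendsto (fun i => P.f0 (s i).x) L (𝓝 (P.f0 xs)) :=
      (hC1.1.continuous.tendsto xs).comp hx
    exact eventually_step_le hC1.1 hx hq hulim hclim (Eventually.of_forall fun _ => le_rfl) le_rfl
      fun _ => hlt
  have hcon : ∀ j, ∀ᶠ z in 𝓝 (0 : ℝ) ×ˢ (L : Filter ι), 0 < z.1 →
      (j ∈ P.Iplus (s z.2).x → P.f j ((s z.2).x + z.1 • P.dirQ p (s z.2) (dt z.2)) ≤
        P.phi (s z.2).x + z.1 * -(p.γ * (P.beta p (s z.2) (dt z.2) *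
          (‖(s z.2).d0‖ + P.phi (s z.2).x ^ p.σ)))) ∧
      (j ∈ P.Iminus (s z.2).x →
        P.f j ((s z.2).x + z.1 • P.dirQ p (s z.2) (dt z.2)) ≤ 0) := by
    intro j
    -- Membership in `I⁻` or `I⁺` is eventually constant along `L`. In both cases a tight bound in
    -- the limit means `c j = 0`, where `q` has slope at most `-βω`; for `I⁺` this beats `-γβω`.
    rcases hbr j with ⟨hev, hcj⟩ | ⟨hev, hcj⟩
    · have hfj : P.f j xs ≤ 0 := le_of_tendsto (((hf j).tendsto xs).comp hx) hev
      have h1 := eventually_step_le (L := (L : Filter ι)) (u := fun _ => 0) (c := fun _ => 0)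
        (hC1.2 j) hx hq tendsto_const_nhds tendsto_const_nhds hev hfj (fun h0 => by
          have := hgjq j (hcj.trans h0)
          change inner ℝ (P.g j xs) qs < 0
          linarith)
      filter_upwards [h1, tendsto_snd.eventually hev] with z hz1 hz2 hz
      refine ⟨fun hp => absurd hp (not_lt.2 hz2), fun _ => ?_⟩
      simpa using hz1 hz
    · have h1 := eventually_step_le (L := (L : Filter ι)) (u := fun i => P.phi (s i).x)
        (c := fun i => -(p.γ * (P.beta p (s i) (dt i) * (‖(s i).d0‖ + P.phi (s i).x ^ p.σ))))
        (hC1.2 j) hx hq hphi (tendsto_const_nhds.mul (hβlim.mul hωlim)).neg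
        (Eventually.of_forall fun i => P.f_le_phi j _) (P.f_le_phi j xs) (fun h0 => by
          have := hgjq j (by rw [hcj, h0, sub_self])
          change inner ℝ (P.g j xs) qs < _
          nlinarith [p.γ_lt])
      filter_upwards [h1, tendsto_snd.eventually hev] with z hz1 hz2 hz
      exact ⟨fun _ => hz1 hz, fun hm => absurd hm (not_le.2 hz2)⟩
  obtain ⟨e, he, pb, hpb, hall⟩ := Metric.eventually_nhds_prod_iff.1
    (hobj.and (eventually_all.2 hcon))
  refine ⟨e / 2, half_pos he, ?_⟩
  filter_upwards [hpb] with i hi t ht0 htT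
  obtain ⟨h1, h2⟩ := hall (x := t) (by rw [Real.dist_0_eq_abs, abs_of_pos ht0]; linarith) hi
  refine ⟨(h1 ht0).trans (le_of_eq (by ring)), fun j hj =>
    ((h2 j ht0).1 hj).trans (le_of_eq (by ring)), fun j hj => (h2 j ht0).2 hj⟩

/-! ### The algorithm is well defined -/

lemma exists_advances {P : NCP n m} {p : SQPParams} (hC1 : P.IsC1) (hLI : P.GradientsIndependent)
    {s : SQPIterate n m} (hs : P.Step1 s) (hns : ¬ P.Stops s) : ∃ x', P.Advances p s x' := by
  classical
  obtain ⟨d1, h1, hd1⟩ : ∃ d1 h1, P.SolvesCorrection p s d1 h1 :=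
    exists_solvesSLE hLI s.x hs.1 s.d0 _
  by_cases h3 : P.Step2Test p s (s.d0 + d1) ∧ ∃ i, P.Step3Accepts p s (s.d0 + d1) i
  · obtain ⟨h2, i, hi⟩ := h3
    exact ⟨_, d1, h1, hd1, Or.inl ⟨h2, i, hi, rfl⟩⟩
  obtain ⟨dt, ht, hdt⟩ : ∃ dt ht, P.SolvesFeasDir p s dt ht :=
    exists_solvesSLE hLI s.x hs.1 s.d0 _
  have hne : s.d0 ≠ 0 ∨ P.phi s.x ≠ 0 := by
    by_contra! h
    exact hns h
  -- The uniform statement for a constant family on a one-point index set yields termination of a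
  -- single line search.
  obtain ⟨T, hT, hall⟩ := (exists_uniform_step5 (L := (pure () : Ultrafilter Unit))
    (s := fun _ => s) (dt := fun _ => dt) (ht := fun _ => ht) hC1 hLI
    (Eventually.of_forall fun _ => hs) tendsto_const_nhds tendsto_const_nhds hs.1
    tendsto_const_nhds hne (Eventually.of_forall fun _ => hdt)).2
  obtain ⟨_, hall⟩ := hall.exists
  obtain ⟨i, hi⟩ := exists_pow_lt_of_lt_one hT p.η_lt
  have hex : ∃ i, P.Step5Test p s dt (p.η ^ i) := ⟨i, hall _ (pow_pos p.η_pos i) hi.le⟩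
  refine ⟨_, d1, h1, hd1, Or.inr ⟨?_, dt, ht, hdt, Nat.find hex,
    ⟨Nat.find_spec hex, fun l hl => Nat.find_min hex hl⟩, rfl⟩⟩
  by_contra! h
  exact h3 h

lemma exists_run_zero {P : NCP n m} {p : SQPParams} (hLI : P.GradientsIndependent)
    (x₀ : EuclideanSpace ℝ (Fin n)) {B₀ : Matrix (Fin n) (Fin n) ℝ} (hB₀ : B₀.PosDef) :
    ∃ s : ℕ → SQPIterate n m, P.IsRun p 0 s ∧ (s 0).x = x₀ ∧ (s 0).B = B₀ := by
  obtain ⟨s, hs, hx, hB⟩ := exists_step1 hLI x₀ hB₀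
  exact ⟨fun _ => s, ⟨fun _ _ => hs, fun k hk => absurd hk (not_lt_of_ge zero_le)⟩, hx, hB⟩

lemma IsRun.exists_extension {P : NCP n m} {p : SQPParams} (hC1 : P.IsC1)
    (hLI : P.GradientsIndependent) {K : ℕ} {s : ℕ → SQPIterate n m} (hs : P.IsRun p K s)
    (hns : ¬ P.Stops (s K)) {B' : Matrix (Fin n) (Fin n) ℝ} (hB' : B'.PosDef) :
    ∃ s' : ℕ → SQPIterate n m, P.IsRun p ((K + 1 : ℕ) : ℕ∞) s' ∧
      (∀ k ≤ K, s' k = s k) ∧ (s' (K + 1)).B = B' := by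
  obtain ⟨x', hx'⟩ := exists_advances (p := p) hC1 hLI (hs.1 K le_rfl) hns
  obtain ⟨u, hu, hux, huB⟩ := exists_step1 hLI x' hB'
  refine ⟨fun k => if k ≤ K then s k else u, ⟨fun k _ => ?_, fun k hk => ?_⟩, fun k hk => ?_, ?_⟩
  · dsimp only
    split_ifs with h
    · exact hs.1 k (by exact_mod_cast h)
    · exact hu
  · have hkK : k ≤ K := Nat.lt_succ_iff.1 (by exact_mod_cast hk)
    dsimp only
    rw [if_pos hkK]
    rcases hkK.lt_or_eq with hlt | rfl
    · rw [if_pos (show k + 1 ≤ K from hlt)]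
      exact hs.2 k (by exact_mod_cast hlt)
    · rw [if_neg (by omega), hux]
      exact ⟨hns, hx'⟩
  · exact if_pos hk
  · dsimp only
    rw [if_neg (by omega)]
    exact huB

/-! ### Limits along ultrafilters -/

/-- The upper bound confines the entries to a compact box; the lower bound survives in the limit and
keeps it definite. -/
lemma exists_tendsto_posDef {ι : Type*} {L : Ultrafilter ι} {B : ι → Matrix (Fin n) (Fin n) ℝ}
    {a b : ℝ} (ha : 0 < a) (hB : ∀ᶠ i in L, (B i).PosDef)
    (hab : ∀ᶠ i in L, ∀ d : EuclideanSpace ℝ (Fin n),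
      a * ‖d‖ ^ 2 ≤ inner ℝ d (act (B i) d) ∧ inner ℝ d (act (B i) d) ≤ b * ‖d‖ ^ 2) :
    ∃ Bs : Matrix (Fin n) (Fin n) ℝ, Bs.PosDef ∧ Tendsto B L (𝓝 Bs) := by
  classical
  let C : Set (Matrix (Fin n) (Fin n) ℝ) :=
    Set.univ.pi fun _ => Set.univ.pi fun _ => Set.Icc (-b) b
  have hC : IsCompact C := isCompact_univ_pi fun _ => isCompact_univ_pi fun _ => isCompact_Icc
  have hmem : ∀ᶠ i in L, B i ∈ C := by
    filter_upwards [hB, hab] with i hi hi2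
    intro k _ l _
    have hentry : ∀ k l, inner ℝ (EuclideanSpace.single k (1 : ℝ))
        (act (B i) (EuclideanSpace.single l 1)) = B i k l := by
      intro k l
      rw [inner_act]
      simp
    have hle : ∀ k l, B i k l = B i l k := fun k l => by
      rw [← hentry, inner_act_comm hi, hentry]
    have hsq : ∀ k : Fin n, ‖(EuclideanSpace.single k (1 : ℝ) : EuclideanSpace ℝ (Fin n))‖ ^ 2 = 1 := by
      intro k; simp
    have hdiag : ∀ k, 0 ≤ B i k k ∧ B i k k ≤ b := fun k => by
      have h1 := hi2 (EuclideanSpace.single k 1)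
      rw [hentry, hsq] at h1
      constructor <;> linarith
    -- Nonnegativity on `e_k ± e_l` gives `2 |B k l| ≤ B k k + B l l ≤ 2b`.
    have h1 := inner_act_nonneg hi (EuclideanSpace.single k 1 + EuclideanSpace.single l 1)
    have h2 := inner_act_nonneg hi (EuclideanSpace.single k 1 + (-1 : ℝ) • EuclideanSpace.single l 1)
    simp only [act_add, act_smul, inner_add_left, inner_add_right, real_inner_smul_left,
      real_inner_smul_right, hentry] at h1 h2
    have h3 := hle k l
    have h4 := hdiag k
    have h5 := hdiag l
    constructor <;> linarith
  obtain ⟨Bs, -, hBs⟩ := hC.ultrafilter_le_nhds' (L.map B) hmem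
  have hBs' : Tendsto B L (𝓝 Bs) := hBs
  refine ⟨Bs, Matrix.PosDef.of_dotProduct_mulVec_pos ?_ fun d hd => ?_, hBs'⟩
  · have h1 : Tendsto (fun i => (B i).conjTranspose) L (𝓝 Bs.conjTranspose) :=
      ((continuous_id.matrix_conjTranspose).tendsto Bs).comp hBs'
    refine tendsto_nhds_unique_of_eventuallyEq h1 hBs' ?_
    filter_upwards [hB] with i hi using hi.1
  · have h1 : Tendsto (fun i => (inner ℝ (WithLp.toLp 2 d) (act (B i) (WithLp.toLp 2 d)) : ℝ)) L
        (𝓝 (inner ℝ (WithLp.toLp 2 d) (act Bs (WithLp.toLp 2 d)))) :=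
      tendsto_const_nhds.inner
        ((continuous_act.tendsto (Bs, WithLp.toLp 2 d)).comp (hBs'.prodMk_nhds tendsto_const_nhds))
    have h2 := ge_of_tendsto h1 (hab.mono fun i hi => (hi (WithLp.toLp 2 d)).1)
    rw [inner_act] at h2
    have h3 : 0 < ‖(WithLp.toLp 2 d : EuclideanSpace ℝ (Fin n))‖ :=
      norm_pos_iff.2 (by simpa using hd)
    have h4 : 0 < a * ‖(WithLp.toLp 2 d : EuclideanSpace ℝ (Fin n))‖ ^ 2 := by positivity
    simpa using h4.trans_le h2

/-- From `a‖d0‖² ≤ -⟪g0, d0⟫ ≤ ‖g0‖ ‖d0‖` the directions are bounded. -/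
lemma exists_tendsto_d0 {P : NCP n m} (hC1 : P.IsC1) {ι : Type*} {L : Ultrafilter ι}
    {s : ι → SQPIterate n m} {a : ℝ} (ha : 0 < a) {xs : EuclideanSpace ℝ (Fin n)}
    (hstep : ∀ᶠ i in L, P.Step1 (s i)) (hx : Tendsto (fun i => (s i).x) L (𝓝 xs))
    (hB : ∀ᶠ i in L, ∀ d : EuclideanSpace ℝ (Fin n), a * ‖d‖ ^ 2 ≤ inner ℝ d (act (s i).B d)) :
    ∃ ds, Tendsto (fun i => (s i).d0) L (𝓝 ds) := by
  have hg0 : Tendsto (fun i => ‖P.g0 (s i).x‖) L (𝓝 ‖P.g0 xs‖) :=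
    ((hC1.continuous_g0.tendsto xs).comp hx).norm
  have hmem : ∀ᶠ i in L, (s i).d0 ∈ Metric.closedBall 0 ((‖P.g0 xs‖ + 1) / a) := by
    filter_upwards [hstep, hB, hg0.eventually_lt_const (lt_add_one _)] with i h1 h2 h3
    rw [mem_closedBall_zero_iff, le_div_iff₀ ha]
    have h4 := h1.inner_g0_d0_le
    have h5 := h2 (s i).d0
    have h6 := (abs_le.1 (abs_real_inner_le_norm (P.g0 (s i).x) (s i).d0)).1
    rcases (norm_nonneg (s i).d0).eq_or_lt with h0 | h0
    · rw [← h0]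
      linarith [norm_nonneg (P.g0 xs)]
    · have h7 : (‖(s i).d0‖ * a) * ‖(s i).d0‖ ≤ ‖P.g0 (s i).x‖ * ‖(s i).d0‖ := by nlinarith
      linarith [le_of_mul_le_mul_right h7 h0]
  obtain ⟨ds, -, hds⟩ := (isCompact_closedBall _ _).ultrafilter_le_nhds'
    (L.map fun i => (s i).d0) hmem
  exact ⟨ds, hds⟩

/-- Limits of the multipliers when the directions `d0` and the constraint violation vanish. -/
lemma exists_tendsto_isKKTPair {P : NCP n m} (hC1 : P.IsC1) (hLI : P.GradientsIndependent)
    {ι : Type*} {L : Ultrafilter ι} {s : ι → SQPIterate n m} {xs : EuclideanSpace ℝ (Fin n)}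
    {Bs : Matrix (Fin n) (Fin n) ℝ}
    (hstep : ∀ᶠ i in L, P.Step1 (s i)) (hx : Tendsto (fun i => (s i).x) L (𝓝 xs))
    (hB : Tendsto (fun i => (s i).B) L (𝓝 Bs)) (hd0 : Tendsto (fun i => (s i).d0) L (𝓝 0))
    (hphi : P.phi xs = 0) :
    ∃ lams, Tendsto (fun i => (s i).lam) L (𝓝 lams) ∧ P.IsKKTPair xs lams := by
  classical
  have hfb : ∀ j, Tendsto (fun i => P.fbar j (s i).x) L (𝓝 (P.f j xs)) := by
    intro j
    obtain ⟨c, hc, -, hbr⟩ := P.exists_tendsto_fbar hC1.continuous_f hx j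
    rw [hphi, sub_zero] at hbr
    rcases hbr with ⟨-, rfl⟩ | ⟨-, rfl⟩ <;> exact hc
  have hg0 : Tendsto (fun i => P.g0 (s i).x) L (𝓝 (P.g0 xs)) :=
    (hC1.continuous_g0.tendsto xs).comp hx
  have hg : ∀ j, Tendsto (fun i => P.g j (s i).x) L (𝓝 (P.g j xs)) := fun j =>
    ((hC1.continuous_g j).tendsto xs).comp hx
  have hact0 : act Bs 0 = (0 : EuclideanSpace ℝ (Fin n)) := by simp [act]
  have hw : Tendsto (fun i => P.g0 (s i).x + act (s i).B (s i).d0) L (𝓝 (P.g0 xs)) := by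
    have := hg0.add ((continuous_act.tendsto (Bs, 0)).comp (hB.prodMk_nhds hd0))
    simpa [hact0] using this
  have hlin : ∀ j, Tendsto (fun i => P.fbar j (s i).x + inner ℝ (P.g j (s i).x) (s i).d0) L
      (𝓝 (P.f j xs)) := fun j => by
    simpa using (hfb j).add ((hg j).inner hd0)
  -- An artificial diagonal: multipliers of indices outside `I(xs)` vanish eventually, so `D j * lam
  -- j = 0` there, while `D` is zero only on independent gradients.
  set D : Fin m → ℝ := fun j => if j ∈ P.active xs then 0 else 1 with hD
  have hDlam : ∀ j, ∀ᶠ i in L, D j * (s i).lam j = 0 := by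
    intro j
    by_cases hj : j ∈ P.active xs
    · simp [hD, hj]
    · have hne : P.f j xs ≠ 0 := fun h => hj (by
        change P.fbar j xs = 0
        rw [P.fbar_eq_f_of_phi_eq_zero hphi, h])
      filter_upwards [(hlin j).eventually_ne hne, hstep] with i hi1 hi2
      rcases mul_eq_zero.1 (hi2.2.2.2 j).2.2 with h | h
      · rw [h, mul_zero]
      · exact absurd h hi1
  have hdet : (saddleMatrix (1 : Matrix (Fin n) (Fin n) ℝ) (fun j => P.g j xs) D).det ≠ 0 := by
    refine det_saddleMatrix_ne_zero Matrix.PosDef.one (fun j => ?_) ?_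
    · simp only [hD]
      split_ifs <;> norm_num
    · have hI : LinearIndepOn ℝ (fun j => P.g j xs) (P.active xs) := hLI xs
      refine hI.mono fun j hj => ?_
      have hj' : D j = 0 := hj
      by_contra h
      simp [hD, h] at hj'
  -- Stationarity says that `(g0 + B d0, lam)` solves a block system with `B` replaced by `1`; its
  -- nonsingular limit makes `lam` converge without a prior bound.
  obtain ⟨-, lams, -, hlam, -⟩ := tendsto_saddleMatrix_solution (L := (L : Filter ι))
    (B := fun _ => 1) (v := fun i j => P.g j (s i).x) (D := fun _ => D)
    (r := fun i j => inner ℝ (P.g j (s i).x) (P.g0 (s i).x + act (s i).B (s i).d0))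
    (h := fun i => (s i).lam) (d := fun i => P.g0 (s i).x + act (s i).B (s i).d0)
    tendsto_const_nhds (tendsto_pi_nhds.2 hg) tendsto_const_nhds
    (tendsto_pi_nhds.2 fun j => (hg j).inner hw) hdet (by
      filter_upwards [hstep, eventually_all.2 hDlam] with i hi1 hi2
      rw [saddleMatrix_mulVec_eq_iff]
      refine ⟨?_, fun j => by rw [hi2 j, sub_zero]⟩
      have h1 : ∀ d : EuclideanSpace ℝ (Fin n), act 1 d = d := fun d => by simp [act]
      rw [h1]
      exact hi1.2.2.1)
  have hlamj := tendsto_pi_nhds.1 hlam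
  refine ⟨lams, hlam, ?_, fun j => ⟨(P.f_le_phi j xs).trans hphi.le, ?_, ?_⟩⟩
  · have h1 : Tendsto (fun i => P.g0 (s i).x + act (s i).B (s i).d0 +
        ∑ j, (s i).lam j • P.g j (s i).x) L (𝓝 (P.g0 xs + ∑ j, lams j • P.g j xs)) :=
      hw.add (tendsto_finsetSum _ fun j _ => (hlamj j).smul (hg j))
    refine tendsto_nhds_unique_of_eventuallyEq h1 tendsto_const_nhds ?_
    filter_upwards [hstep] with i hi using hi.2.2.1
  · exact ge_of_tendsto (hlamj j) (hstep.mono fun i hi => (hi.2.2.2 j).2.1)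
  · refine tendsto_nhds_unique_of_eventuallyEq ((hlamj j).mul (hlin j)) tendsto_const_nhds ?_
    filter_upwards [hstep] with i hi using (hi.2.2.2 j).2.2

lemma Stops.isKKTPoint {P : NCP n m} {s : SQPIterate n m} (h : P.Stops s) (hs : P.Step1 s) :
    P.IsKKTPoint s.x := by
  obtain ⟨hd, hphi⟩ := h
  obtain ⟨-, -, h1, h2⟩ := hs
  have hact0 : act s.B 0 = (0 : EuclideanSpace ℝ (Fin n)) := by simp [act]
  rw [hd, hact0, add_zero] at h1
  refine ⟨s.lam, h1, fun j => ⟨(P.f_le_phi j s.x).trans hphi.le, (h2 j).2.1, ?_⟩⟩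
  have h3 := (h2 j).2.2
  rwa [hd, inner_zero_right, add_zero, P.fbar_eq_f_of_phi_eq_zero hphi] at h3

/-! ### Descent -/

lemma phi_le_max_of_tests {x x' : EuclideanSpace ℝ (Fin n)} {κ : ℝ}
    (hp : ∀ j ∈ P.Iplus x, P.f j x' ≤ P.phi x - κ) (hm : ∀ j ∈ P.Iminus x, P.f j x' ≤ 0) :
    P.phi x' ≤ max 0 (P.phi x - κ) := by
  refine P.phi_le_iff.2 ⟨le_max_left _ _, fun j => ?_⟩
  rcases le_or_gt (P.f j x) 0 with h | h
  · exact (hm j h).trans (le_max_left _ _)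
  · exact (hp j h).trans (le_max_right _ _)

/-- One iteration decreases the constraint violation by `Δ`, unless it becomes zero, and, from
feasible points, the objective by `Δ'`. -/
lemma Advances.exists_decrease {P : NCP n m} {p : SQPParams} {s : SQPIterate n m}
    {x' : EuclideanSpace ℝ (Fin n)} (hs : P.Step1 s) (h : P.Advances p s x') :
    ∃ Δ Δ' : ℝ, 0 ≤ Δ ∧ 0 ≤ Δ' ∧ P.phi x' ≤ max 0 (P.phi s.x - Δ) ∧
      (P.phi s.x = 0 → P.f0 x' ≤ P.f0 s.x - Δ') ∧
      ((p.α * p.ε * (‖s.d0‖ ^ p.τ + P.phi s.x ^ p.σ) ≤ Δ ∧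
          p.α * p.ε * -inner ℝ (P.g0 s.x) s.d0 ≤ Δ') ∨
        ∃ (z : EuclideanSpace ℝ (Fin n) × (Fin m → ℝ) × ℕ), P.SolvesFeasDir p s z.1 z.2.1 ∧
          P.Step5Accepts p s z.1 z.2.2 ∧
          Δ = p.γ * p.η ^ z.2.2 * P.beta p s z.1 * (‖s.d0‖ + P.phi s.x ^ p.σ) ∧
          Δ' = p.γ * p.η ^ z.2.2 * (p.θ * -inner ℝ (P.g0 s.x) s.d0)) := by
  have hg := hs.inner_g0_d0_nonpos
  have hφσ := Real.rpow_nonneg (P.phi_nonneg s.x) p.σ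
  have hnτ := Real.rpow_nonneg (norm_nonneg s.d0) p.τ
  have hα := p.α_pos
  have hγ := p.γ_pos
  have hε := p.ε_pos
  have hη := p.η_pos
  have hθ := p.θ_pos
  have hneg : 0 ≤ -inner ℝ (P.g0 s.x) s.d0 := by linarith
  obtain ⟨d1, h1, -, ⟨-, i, ⟨hi, ⟨ht1, ht2, ht3⟩, -⟩, rfl⟩ | ⟨-, dt, ht, hsol, i, hacc, rfl⟩⟩ := h
  · refine ⟨p.α * (1 / 2) ^ i * (‖s.d0‖ ^ p.τ + P.phi s.x ^ p.σ),
      p.α * (1 / 2) ^ i * -inner ℝ (P.g0 s.x) s.d0, by positivity,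
      mul_nonneg (by positivity) hneg, P.phi_le_max_of_tests ht2 ht3, fun h0 => ?_,
      Or.inl ⟨by gcongr, by gcongr⟩⟩
    rw [h0, Real.zero_rpow p.θ_pos.ne', mul_zero, add_zero] at ht1
    linarith
  · obtain ⟨⟨ht1, ht2, ht3⟩, -⟩ := id hacc
    have hβ := hs.beta_nonneg p dt
    refine ⟨_, _, by positivity, mul_nonneg (by positivity) (mul_nonneg hθ.le hneg),
      P.phi_le_max_of_tests ht2 ht3, fun h0 => ?_, Or.inr ⟨(dt, ht, i), hsol, hacc, rfl, rfl⟩⟩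
    -- At a feasible point `phi ^ θ = 0`, so the slope along `q` is at most `θ * ⟪g0, d0⟫`.
    have hq := hs.inner_g0_dirQ_le p dt
    rw [h0, Real.zero_rpow p.θ_pos.ne', add_zero] at hq
    rw [h0, Real.zero_rpow p.θ_pos.ne', mul_zero, add_zero] at ht1
    have h2 : 0 < p.γ * p.η ^ i := by positivity
    have h3 := mul_le_mul_of_nonneg_left hq h2.le
    dsimp only
    linarith

lemma exists_pos_eventually_le {ι : Type*} {L : Filter ι} {q Δ : ι → ℝ} {Q : ℝ}
    (hq : Tendsto q L (𝓝 Q)) (hQ : 0 < Q) (h : ∀ᶠ i in L, q i ≤ Δ i) :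
    ∃ c > 0, ∀ᶠ i in L, c ≤ Δ i := by
  refine ⟨Q / 2, half_pos hQ, ?_⟩
  filter_upwards [h, hq.eventually_const_lt (half_lt_self hQ)] with i h1 h2
  linarith

/-- An eventually decreasing sequence with a limit along some ultrafilter has vanishing
decrements. -/
lemma tendsto_sub_succ_of_ultrafilter {F : ℕ → ℝ} {k₀ : ℕ} (hF : ∀ k ≥ k₀, F (k + 1) ≤ F k)
    {L : Ultrafilter ℕ} (hL : (L : Filter ℕ) ≤ atTop) {c : ℝ} (hc : Tendsto F L (𝓝 c)) :
    Tendsto (fun k => F k - F (k + 1)) L (𝓝 0) := by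
  have hanti : Antitone fun k => F (k + k₀) := antitone_nat_of_succ_le fun k => by
    have := hF (k + k₀) (by omega)
    rwa [show k + 1 + k₀ = k + k₀ + 1 by omega]
  -- Divergence to `-∞` is excluded by the limit along `L`, so the whole sequence converges.
  rcases tendsto_atTop_of_antitone hanti with h | ⟨l, h⟩
  · have h' : Tendsto F atTop atBot := (tendsto_add_atTop_iff_nat k₀).1 h
    exact absurd hc (not_tendsto_nhds_of_tendsto_atBot (h'.mono_left hL) c)
  · have h' : Tendsto F atTop (𝓝 l) := (tendsto_add_atTop_iff_nat k₀).1 h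
    have h2 := h'.sub ((tendsto_add_atTop_iff_nat 1).2 h')
    rw [sub_self] at h2
    exact h2.mono_left hL

/-- If `i > 0`, the preceding trial `η ^ (i - 1)` was rejected and therefore exceeds `T`. -/
lemma Step5Accepts.min_le {P : NCP n m} {p : SQPParams} {s : SQPIterate n m}
    {dt : EuclideanSpace ℝ (Fin n)} {i : ℕ} (h : P.Step5Accepts p s dt i) {T : ℝ}
    (hT : ∀ t, 0 < t → t ≤ T → P.Step5Test p s dt t) : min 1 (p.η * T) ≤ p.η ^ i := by
  rcases i with _ | i
  · simp
  · refine (min_le_right _ _).trans ?_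
    rw [pow_succ']
    refine mul_le_mul_of_nonneg_left ?_ p.η_pos.le
    by_contra! hlt
    exact h.2 i (Nat.lt_succ_self i) (hT _ (pow_pos p.η_pos i) hlt.le)

/-- Along an ultrafilter on which the points of an infinite run converge, the directions `d0` and
the constraint violation tend to zero. -/
theorem IsRun.limit_eq_zero {P : NCP n m} {p : SQPParams} (hC1 : P.IsC1)
    (hLI : P.GradientsIndependent) {s : ℕ → SQPIterate n m} (hs : P.IsRun p ⊤ s)
    {L : Ultrafilter ℕ} (hL : (L : Filter ℕ) ≤ atTop) {xs ds : EuclideanSpace ℝ (Fin n)}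
    {Bs : Matrix (Fin n) (Fin n) ℝ} (hx : Tendsto (fun k => (s k).x) L (𝓝 xs))
    (hB : Tendsto (fun k => (s k).B) L (𝓝 Bs)) (hBs : Bs.PosDef)
    (hd0 : Tendsto (fun k => (s k).d0) L (𝓝 ds)) : ds = 0 ∧ P.phi xs = 0 := by
  by_contra hcon
  have hne : ds ≠ 0 ∨ P.phi xs ≠ 0 := by tauto
  have hstep : ∀ k, P.Step1 (s k) := fun k => hs.1 k le_top
  have hadv : ∀ k, P.Advances p (s k) (s (k + 1)).x := fun k =>
    (hs.2 k (ENat.natCast_lt_top k)).2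
  choose Δ Δ' hΔ hΔ' hphi hf0 hdesc using fun k => (hadv k).exists_decrease (hstep k)
  have hσ0 : 0 < p.σ := p.θ_pos.trans p.θ_lt
  have hα := p.α_pos
  have hγ := p.γ_pos
  have hε := p.ε_pos
  have hη := p.η_pos
  have hθ := p.θ_pos
  have hφσ := tendsto_phi_rpow hC1 hx hσ0
  have hphi0 := P.phi_nonneg xs
  have hφσ0 := Real.rpow_nonneg hphi0 p.σ
  have hφpos : P.phi xs ≠ 0 → 0 < P.phi xs ^ p.σ := fun h =>
    Real.rpow_pos_of_pos (lt_of_le_of_ne hphi0 h.symm) _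
  have hg0 : Tendsto (fun i => P.g0 (s i).x) L (𝓝 (P.g0 xs)) :=
    (hC1.continuous_g0.tendsto xs).comp hx
  have hgd : Tendsto (fun k => -inner ℝ (P.g0 (s k).x) (s k).d0) L (𝓝 (-inner ℝ (P.g0 xs) ds)) :=
    (hg0.inner hd0).neg
  have hgdpos : ds ≠ 0 → 0 < -inner ℝ (P.g0 xs) ds := by
    intro h
    have h1 : inner ℝ (P.g0 xs) ds ≤ -inner ℝ ds (act Bs ds) := by
      refine le_of_tendsto_of_tendsto (hg0.inner hd0)
        (hd0.inner ((continuous_act.tendsto (Bs, ds)).comp (hB.prodMk_nhds hd0))).neg ?_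
      exact Eventually.of_forall fun i => (hstep i).inner_g0_d0_le
    linarith [inner_act_pos hBs h]
  -- lower bounds for the decrements
  have hlow : (∃ c > 0, ∀ᶠ k in L, c ≤ Δ k) ∧ (ds ≠ 0 → ∃ c > 0, ∀ᶠ k in L, c ≤ Δ' k) := by
    -- The ultrafilter selects one of Steps 3 and 5 as the one that produces the iterates.
    rcases Ultrafilter.eventually_or.1 (Eventually.of_forall hdesc : ∀ᶠ k in L, _) with h3 | h5
    · refine ⟨exists_pos_eventually_le (((hd0.norm.rpow_const (p := p.τ)
        (Or.inr (by linarith [p.τ_gt]))).add hφσ).const_mul (p.α * p.ε)) ?_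
          (h3.mono fun k hk => hk.1), fun hds => exists_pos_eventually_le
            (hgd.const_mul (p.α * p.ε)) (mul_pos (by positivity) (hgdpos hds))
              (h3.mono fun k hk => hk.2)⟩
      refine mul_pos (by positivity) ?_
      have h1 := Real.rpow_nonneg (norm_nonneg ds) p.τ
      rcases hne with h | h
      · linarith [Real.rpow_pos_of_pos (norm_pos_iff.2 h) p.τ]
      · linarith [hφpos h]
    · obtain ⟨z, hz⟩ := Filter.skolem.1 h5
      obtain ⟨⟨b, hb, hβb⟩, T, hT, hTall⟩ := exists_uniform_step5 hC1 hLI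
        (Eventually.of_forall hstep) hx hB hBs hd0 hne (hz.mono fun k hk => hk.1)
      have hμ : 0 < min 1 (p.η * T) := lt_min one_pos (by positivity)
      have hpow : ∀ᶠ k in L, min 1 (p.η * T) ≤ p.η ^ (z k).2.2 := by
        filter_upwards [hz, hTall] with k hk1 hk2 using hk1.2.1.min_le hk2
      refine ⟨exists_pos_eventually_le ((hd0.norm.add hφσ).const_mul
          (p.γ * min 1 (p.η * T) * b)) ?_ ?_, fun hds => exists_pos_eventually_le
            ((hgd.const_mul p.θ).const_mul (p.γ * min 1 (p.η * T)))
              (mul_pos (by positivity) (mul_pos hθ (hgdpos hds))) ?_⟩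
      · refine mul_pos (by positivity) ?_
        rcases hne with h | h
        · linarith [norm_pos_iff.2 h]
        · linarith [hφpos h, norm_nonneg ds]
      · filter_upwards [hz, hpow, hβb] with k hk1 hk2 hk3
        rw [hk1.2.2.1]
        have := Real.rpow_nonneg (P.phi_nonneg (s k).x) p.σ
        gcongr
      · filter_upwards [hz, hpow] with k hk1 hk2
        rw [hk1.2.2.2]
        have h1 : 0 ≤ p.θ * -inner ℝ (P.g0 (s k).x) (s k).d0 :=
          mul_nonneg hθ.le (by linarith [(hstep k).inner_g0_d0_nonpos])
        gcongr
  have habsurd : ∀ (F : ℕ → ℝ) (k₀ : ℕ) (G : ℕ → ℝ) (l : ℝ), Tendsto F L (𝓝 l) →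
      (∀ k, 0 ≤ G k) → (∀ k ≥ k₀, F (k + 1) ≤ F k - G k) → ¬ ∃ c > 0, ∀ᶠ k in L, c ≤ G k := by
    rintro F k₀ G l hF hG hdec ⟨c, hc, hcG⟩
    have h1 := tendsto_sub_succ_of_ultrafilter (k₀ := k₀)
      (fun k hk => by linarith [hdec k hk, hG k]) hL hF
    have h2 : c ≤ 0 := ge_of_tendsto h1 (by
      filter_upwards [hcG, hL (eventually_ge_atTop k₀)] with k hk1 hk2
      linarith [hdec k hk2])
    linarith
  have hφlim : Tendsto (fun k => P.phi (s k).x) L (𝓝 (P.phi xs)) :=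
    ((P.continuous_phi hC1.continuous_f).tendsto xs).comp hx
  -- Once the violation is zero it stays zero, and `f0` is the monotone quantity; otherwise `phi`
  -- never reaches zero and strictly follows its decrements.
  by_cases hzero : ∃ k₀, P.phi (s k₀).x = 0
  · obtain ⟨k₀, hk₀⟩ := hzero
    have hall : ∀ k ≥ k₀, P.phi (s k).x = 0 := by
      intro k hk
      induction k, hk using Nat.le_induction with
      | base => exact hk₀
      | succ k _ ih =>
        have h1 := hphi k
        rw [ih, max_eq_left (by linarith [hΔ k])] at h1
        exact le_antisymm h1 (P.phi_nonneg _)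
    have hxs : P.phi xs = 0 := tendsto_nhds_unique_of_eventuallyEq hφlim tendsto_const_nhds
      (hL (eventually_ge_atTop k₀ |>.mono hall))
    have hds : ds ≠ 0 := hne.resolve_right (not_not.2 hxs)
    exact habsurd (fun k => P.f0 (s k).x) k₀ Δ' _ ((hC1.1.continuous.tendsto xs).comp hx) hΔ'
      (fun k hk => hf0 k (hall k hk)) (hlow.2 hds)
  · push Not at hzero
    refine habsurd (fun k => P.phi (s k).x) 0 Δ _ hφlim hΔ (fun k _ => ?_) hlow.1
    rcases le_max_iff.1 (hphi k) with h | h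
    · exact absurd (le_antisymm h (P.phi_nonneg _)) (hzero (k + 1))
    · exact h

end

end NCP

theorem theorem1 {n m : ℕ} (P : NCP n m) (p : SQPParams)
    (hC1 : P.IsC1) (hLI : P.GradientsIndependent) :
    -- the algorithm can be started at every point, with every symmetric positive definite matrix
    (∀ (x₀ : EuclideanSpace ℝ (Fin n)) (B₀ : Matrix (Fin n) (Fin n) ℝ), B₀.PosDef →
      ∃ s : ℕ → SQPIterate n m, P.IsRun p 0 s ∧ (s 0).x = x₀ ∧ (s 0).B = B₀) ∧
    -- as long as it does not stop, it can go on, whatever the next matrix is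
    (∀ (K : ℕ) (s : ℕ → SQPIterate n m), P.IsRun p K s → ¬ P.Stops (s K) →
      ∀ B' : Matrix (Fin n) (Fin n) ℝ, B'.PosDef →
        ∃ s' : ℕ → SQPIterate n m, P.IsRun p ((K + 1 : ℕ) : ℕ∞) s' ∧
          (∀ k ≤ K, s' k = s k) ∧ (s' (K + 1)).B = B') ∧
    -- it stops at a KKT point, or it is infinite and its accumulation points are KKT points
    (∀ (N : ℕ∞) (s : ℕ → SQPIterate n m), P.IsMaximalRun p N s → UniformlyPosDef N s →
      (∃ K : ℕ, N = K ∧ P.Stops (s K) ∧ P.IsKKTPoint (s K).x) ∨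
      (N = ⊤ ∧ ∀ xs : EuclideanSpace ℝ (Fin n),
        MapClusterPt xs Filter.atTop (fun k => (s k).x) →
          P.IsKKTPoint xs ∧
          ∃ (lams : Fin m → ℝ) (ψ : ℕ → ℕ), StrictMono ψ ∧
            Filter.Tendsto (fun i => (s (ψ i)).x) Filter.atTop (nhds xs) ∧
            Filter.Tendsto (fun i => (s (ψ i)).lam) Filter.atTop (nhds lams) ∧
            P.IsKKTPair xs lams)) := by
  refine ⟨fun x₀ B₀ hB₀ => NCP.exists_run_zero hLI x₀ hB₀,
    fun K s hs hns B' hB' => hs.exists_extension hC1 hLI hns hB', ?_⟩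
  rintro N s ⟨hrun, hmax⟩ ⟨a, b, ha, -, hab⟩
  induction N using ENat.recTopCoe with
  | coe K =>
    left
    have hterm : P.Stops (s K) := by
      by_contra hns
      -- Any positive definite next matrix contradicts maximality; the identity will do.
      obtain ⟨s', hs', hs's, -⟩ := hrun.exists_extension hC1 hLI hns Matrix.PosDef.one
      exact hmax K rfl ⟨s', hs', hs's⟩
    exact ⟨K, rfl, hterm, hterm.isKKTPoint (hrun.1 K le_rfl)⟩
  | top =>
    refine Or.inr ⟨rfl, fun xs hxs => ?_⟩
    obtain ⟨L, hL, hx⟩ := mapClusterPt_iff_ultrafilter.1 hxs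
    have hstep : ∀ᶠ k in (L : Filter ℕ), P.Step1 (s k) := Filter.Eventually.of_forall fun k => hrun.1 k le_top
    obtain ⟨Bs, hBs, hB⟩ := NCP.exists_tendsto_posDef (L := L) (B := fun k => (s k).B) ha
      (hstep.mono fun k hk => hk.1) (Filter.Eventually.of_forall fun k d => hab k le_top d)
    obtain ⟨ds, hd0⟩ := NCP.exists_tendsto_d0 hC1 ha hstep hx
      (Filter.Eventually.of_forall fun k d => (hab k le_top d).1)
    obtain ⟨rfl, hphi⟩ := hrun.limit_eq_zero hC1 hLI hL hx hB hBs hd0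
    obtain ⟨lams, hlam, hkkt⟩ := NCP.exists_tendsto_isKKTPair hC1 hLI hstep hx hB hd0 hphi
    -- Only here is the ultrafilter traded for a subsequence, for points and multipliers jointly.
    have hcl : MapClusterPt (xs, lams) Filter.atTop fun k => ((s k).x, (s k).lam) :=
      mapClusterPt_iff_ultrafilter.2 ⟨L, hL, hx.prodMk_nhds hlam⟩
    obtain ⟨ψ, hψ, hlim⟩ := hcl.tendsto_subseq
    exact ⟨⟨lams, hkkt⟩, lams, ψ, hψ, (continuous_fst.tendsto _).comp hlim,
      (continuous_snd.tendsto _).comp hlim, hkkt⟩
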